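/- Let $(M,g,J)$ be a compact Kähler manifold (without boundary) of real dimension $n\ge 4$; that is, $g$ is a Riemannian metric and $J$ is a $g$-orthogonal almost complex structure which is parallel with respect to the Levi-Civita connection of $g$. Let $D$ be a Weyl connection on $(M,g)$, i.e. a torsion-free linear connection on $\mathrm{T}M$ such that $Dg=-2\theta\otimes g$ for some $1$-form $\theta$, called the Lee form of $D$ with respect to $g$. Assume that $D$ defines a conformal product structure of rank $1$ on $(M,g)$, i.e. that there is a $g$-orthogonal direct sum decomposition $\mathrm{T}M=T_1\oplus T_2$ into smooth $D$-parallel distributions with $\dim(T_1)\ge\dim(T_2)=1$. Then the Lee form $\theta$ vanishes on $T_2$, i.e. $\theta_x(v)=0$ for every $x\in M$ and every $v\in (T_2)_x$. (All objects are of class $C^\infty$.) -/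

import Mathlib

open Bundle
open scoped Manifold ContDiff Topology

noncomputable section

namespace ConformalProduct

section

variable {E : Type*} [NormedAddCommGroup E] [NormedSpace ℝ E]
  {H : Type*} [TopologicalSpace H] {I : ModelWithCorners ℝ E H}
  {M : Type*} [TopologicalSpace M] [ChartedSpace H M] [IsManifold I ∞ M]

/-- A smooth `1`-form on `M`: a smooth section of the cotangent bundle. -/
def IsSmoothOneForm (θ : Π x : M, TangentSpace I x →L[ℝ] ℝ) : Prop :=
  ContMDiff I (I.prod 𝓘(ℝ, E →L[ℝ] ℝ)) ∞
    (fun x ↦ TotalSpace.mk' (E →L[ℝ] ℝ)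
      (E := fun x : M ↦ TangentSpace I x →L[ℝ] Bundle.Trivial M ℝ x) x (θ x))

/-- A smooth field of endomorphisms of the tangent bundle. -/
def IsSmoothEndomorphism (J : Π x : M, TangentSpace I x →L[ℝ] TangentSpace I x) : Prop :=
  ContMDiff I (I.prod 𝓘(ℝ, E →L[ℝ] E)) ∞
    (fun x ↦ TotalSpace.mk' (E →L[ℝ] E)
      (E := fun x : M ↦ TangentSpace I x →L[ℝ] TangentSpace I x) x (J x))

/-- A smooth distribution of rank `r`, i.e. a smooth rank `r` subbundle of the tangent bundle:
near every point it is spanned by `r` smooth, pointwise linearly independent vector fields. -/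
def IsSmoothDistribution (T : Π x : M, Submodule ℝ (TangentSpace I x)) (r : ℕ) : Prop :=
  ∀ x₀ : M, ∃ U : Set M, IsOpen U ∧ x₀ ∈ U ∧
    ∃ X : Fin r → Π x : M, TangentSpace I x,
      (∀ i, ContMDiffOn I I.tangent ∞ (fun x ↦ (⟨x, X i x⟩ : TangentBundle I M)) U) ∧
      ∀ x ∈ U, LinearIndependent ℝ (fun i ↦ X i x) ∧
        Submodule.span ℝ (Set.range fun i ↦ X i x) = T x

/-- The endomorphism field `J` is parallel for the connection `D`, i.e.
`(D_v J) Y = D_v (J Y) - J (D_v Y) = 0` for all tangent vectors `v` and all (locally defined)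
smooth vector fields `Y`. -/
def IsParallelEndomorphism (D : CovariantDerivative I E (TangentSpace I : M → Type _))
    (J : Π x : M, TangentSpace I x →L[ℝ] TangentSpace I x) : Prop :=
  ∀ (U : Set M), IsOpen U → ∀ (Y : Π x : M, TangentSpace I x),
    ContMDiffOn I I.tangent ∞ (fun x ↦ (⟨x, Y x⟩ : TangentBundle I M)) U →
    ∀ x ∈ U, ∀ v : TangentSpace I x, D (fun y ↦ J y (Y y)) x v - J x (D Y x v) = 0

/-- The distribution `T` is parallel for the connection `D`: if `Y` is a (locally defined) smooth
section of `T`, so is `D_v Y` for all tangent vectors `v`. -/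
def IsParallelDistribution (D : CovariantDerivative I E (TangentSpace I : M → Type _))
    (T : Π x : M, Submodule ℝ (TangentSpace I x)) : Prop :=
  ∀ (U : Set M), IsOpen U → ∀ (Y : Π x : M, TangentSpace I x),
    ContMDiffOn I I.tangent ∞ (fun x ↦ (⟨x, Y x⟩ : TangentBundle I M)) U →
    (∀ x ∈ U, Y x ∈ T x) →
    ∀ x ∈ U, ∀ v : TangentSpace I x, D Y x v ∈ T x

variable [FiniteDimensional ℝ E] [RiemannianBundle (fun x : M ↦ TangentSpace I x)]
  [IsContMDiffRiemannianBundle I ∞ E (fun x : M ↦ TangentSpace I x)]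

/-- The Levi-Civita connection of the metric: a smooth linear connection which is torsion-free and
metric. -/
structure IsLeviCivita (nabla : CovariantDerivative I E (TangentSpace I : M → Type _)) : Prop where
  smooth : nabla.ContMDiffCovariantDerivative ∞
  torsion_eq_zero : nabla.torsion = 0
  metric : CovariantDerivative.IsMetricCompatible (V := (TangentSpace I : M → Type _)) nabla

/-- `(M, g, J)` is Kähler: `J` is a smooth almost complex structure, orthogonal for `g`, and parallel
for the Levi-Civita connection of `g`. -/
structure IsKaehler (J : Π x : M, TangentSpace I x →L[ℝ] TangentSpace I x) : Prop where
  smooth : IsSmoothEndomorphism J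
  sq_eq_neg : ∀ (x : M) (v : TangentSpace I x), J x (J x v) = -v
  orthogonal : ∀ (x : M) (v w : TangentSpace I x), inner ℝ (J x v) (J x w) = inner ℝ v w
  parallel : ∃ nabla : CovariantDerivative I E (TangentSpace I : M → Type _),
    IsLeviCivita nabla ∧ IsParallelEndomorphism nabla J

/-- `θ` is the Lee form of `D` with respect to the metric `g`: it is a smooth `1`-form and
`D g = -2 θ ⊗ g`, i.e. `(D_X g)(Y, Z) = -2 θ(X) g(Y, Z)`.
Here `D.derivMetricTensor x Y Z X` is `(D_X g)(Y, Z) = X(g(Y, Z)) - g(D_X Y, Z) - g(Y, D_X Z)`. -/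
structure IsLeeForm (D : CovariantDerivative I E (TangentSpace I : M → Type _))
    (θ : Π x : M, TangentSpace I x →L[ℝ] ℝ) : Prop where
  smooth : IsSmoothOneForm θ
  derivMetric : ∀ (x : M) (X Y Z : TangentSpace I x),
    D.derivMetricTensor x Y Z X = -2 * θ x X * inner ℝ Y Z

/-- A Weyl connection: a torsion-free smooth linear connection `D` with `D g = -2 θ ⊗ g` for some
`1`-form `θ`. -/
structure IsWeylConnection (D : CovariantDerivative I E (TangentSpace I : M → Type _)) :
    Prop where
  smooth : D.ContMDiffCovariantDerivative ∞
  torsion_eq_zero : D.torsion = 0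
  exists_leeForm : ∃ θ : Π x : M, TangentSpace I x →L[ℝ] ℝ, IsLeeForm D θ

/-- A conformal product structure of rank `r ≥ 1`: a Weyl connection `D` and an orthogonal,
`D`-parallel decomposition `TM = T₁ ⊕ T₂` into smooth distributions with `dim T₁ ≥ dim T₂ = r`. -/
structure IsConformalProductStructure
    (D : CovariantDerivative I E (TangentSpace I : M → Type _))
    (T₁ T₂ : Π x : M, Submodule ℝ (TangentSpace I x)) (r : ℕ) : Prop where
  weyl : IsWeylConnection D
  one_le_rank : 1 ≤ r
  distribution₁ : ∃ s : ℕ, r ≤ s ∧ IsSmoothDistribution T₁ s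
  distribution₂ : IsSmoothDistribution T₂ r
  isCompl : ∀ x : M, IsCompl (T₁ x) (T₂ x)
  orthogonal : ∀ (x : M), ∀ v ∈ T₁ x, ∀ w ∈ T₂ x, inner ℝ v w = 0
  parallel₁ : IsParallelDistribution D T₁
  parallel₂ : IsParallelDistribution D T₂

end

end ConformalProduct

end

/-! Let n be the real dimension, ξ a local unit section of T₂ and Z the metric dual of θ. Since D
preserves the line of ξ and changes g by the Lee form, Dξ = θ ⊗ ξ. Comparing D with the Levi-Civita
connection ∇ gives ∇_v ξ = -θ(ξ) v + g(v, ξ) Z (`IsLeeForm.cov_unit`).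

Every vector field Y satisfies div(∇_Y Y - (div Y) Y) = tr((∇Y)²) - (div Y)² + Ric(Y, Y)
(`trace_covDeriv_bochnerField`). The Ricci term has no sign in general, but on a Kähler manifold
Ric(Jξ, Jξ) = Ric(ξ, ξ) (`IsKaehlerChart.trace_curvEnd_complex`). Subtracting the identity for Jξ
from the one for ξ removes the curvature, and the rest is algebra in ∇ξ: the difference V of the two
fields satisfies div V = -(n - 2)² θ(ξ)² (`IsKaehlerChart.trace_covDeriv_bochnerDifference`).

V is quadratic in ξ, so it does not see the sign of ξ and is a global smooth field even when T₂ is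
not orientable. On a compact manifold a field of nonpositive divergence is divergence-free
(`divergence_eq_zero_of_nonpos`), so (n - 2)² θ(ξ)² = 0 and θ(ξ) = 0.

Curvature is handled in charts through Christoffel symbols `Γ p w v`, where `w` is the
differentiated vector and `v` the direction. The divergence theorem is obtained from Euclidean
integration by parts, the density √det g and a partition of unity. -/

noncomputable section

namespace ConformalProduct

/-! ### Connections and curvature in coordinates. -/

section ChartCalculus

variable {E : Type*} [NormedAddCommGroup E] [NormedSpace ℝ E]

/-- The covariant derivative of a vector field on `E` for the connection with
Christoffel symbols `Γ`. -/
def covDeriv (Γ : E → E →L[ℝ] E →L[ℝ] E) (Y : E → E) (p : E) : E →L[ℝ] E :=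
  fderiv ℝ Y p + Γ p (Y p)

/-- The endomorphism `x ↦ R(x, y) z`, where `R` is the curvature of the connection with Christoffel
symbols `Γ`. -/
def curvEnd (Γ : E → E →L[ℝ] E →L[ℝ] E) (p y z : E) : E →L[ℝ] E :=
  ((fderiv ℝ Γ p).flip z).flip y - fderiv ℝ Γ p y z + Γ p (Γ p z y) - (Γ p).flip y ∘L Γ p z

lemma curvEnd_apply (Γ : E → E →L[ℝ] E →L[ℝ] E) (p x y z : E) :
    curvEnd Γ p y z x = fderiv ℝ Γ p x z y - fderiv ℝ Γ p y z x + Γ p (Γ p z y) x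
      - Γ p (Γ p z x) y := rfl

lemma hasFDerivAt_covDeriv {Γ : E → E →L[ℝ] E →L[ℝ] E} {Y : E → E} {p : E}
    (hΓ : DifferentiableAt ℝ Γ p) (hY : ContDiffAt ℝ 2 Y p) :
    HasFDerivAt (covDeriv Γ Y) (fderiv ℝ (fderiv ℝ Y) p +
      ((Γ p) ∘L (fderiv ℝ Y p) + (fderiv ℝ Γ p).flip (Y p))) p := by
  have h1 : HasFDerivAt (fderiv ℝ Y) (fderiv ℝ (fderiv ℝ Y) p) p :=
    ((hY.fderiv_right (m := 1) le_rfl).differentiableAt one_ne_zero).hasFDerivAt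
  have h2 := hΓ.hasFDerivAt.clm_apply (hY.differentiableAt two_ne_zero).hasFDerivAt
  exact h1.add h2

lemma fderiv_covDeriv_apply {Γ : E → E →L[ℝ] E →L[ℝ] E} {Y : E → E} {p : E}
    (hΓ : DifferentiableAt ℝ Γ p) (hY : ContDiffAt ℝ 2 Y p) (x w : E) :
    fderiv ℝ (covDeriv Γ Y) p x w = fderiv ℝ (fderiv ℝ Y) p x w + Γ p (fderiv ℝ Y p x) w
      + fderiv ℝ Γ p x (Y p) w := by
  rw [(hasFDerivAt_covDeriv hΓ hY).fderiv]
  simp [add_assoc]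



set_option synthInstance.maxHeartbeats 200000 in
lemma fderiv_christoffel_symm {Γ : E → E →L[ℝ] E →L[ℝ] E} {p : E} (hΓ : DifferentiableAt ℝ Γ p)
    (hsymm : ∀ᶠ q in 𝓝 p, ∀ v w, Γ q v w = Γ q w v) (x v w : E) :
    fderiv ℝ Γ p x v w = fderiv ℝ Γ p x w v := by
  have h : ∀ v w : E, HasFDerivAt (fun q ↦ Γ q v w) (((fderiv ℝ Γ p).flip v).flip w) p := by
    intro v w
    have := (hΓ.hasFDerivAt.clm_apply (hasFDerivAt_const v p)).clm_apply (hasFDerivAt_const w p)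
    convert this using 1
    ext; simp
  have h2 := (h w v).congr_of_eventuallyEq (f₁ := fun q ↦ Γ q v w) (hsymm.mono fun q hq ↦ hq v w)
  exact congrArg (fun L ↦ L x) ((h v w).unique h2)

/-- The first Bianchi identity. -/
lemma curvEnd_bianchi {Γ : E → E →L[ℝ] E →L[ℝ] E} {p : E} (hΓ : DifferentiableAt ℝ Γ p)
    (hsymm : ∀ᶠ q in 𝓝 p, ∀ v w, Γ q v w = Γ q w v) (x y z : E) :
    curvEnd Γ p y z x + curvEnd Γ p z x y + curvEnd Γ p x y z = 0 := by
  have hs := hsymm.self_of_nhds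
  have hd := fderiv_christoffel_symm hΓ hsymm
  simp only [curvEnd_apply]
  rw [hd x z y, hd y z x, hd z y x, hs z y, hs z x, hs y x]
  abel

lemma curvEnd_swap (Γ : E → E →L[ℝ] E →L[ℝ] E) (p x y z : E) :
    curvEnd Γ p y z x = - curvEnd Γ p x z y := by
  simp only [curvEnd_apply]; abel

set_option synthInstance.maxHeartbeats 200000 in
/-- The curvature commutes with a parallel endomorphism. -/
lemma curvEnd_parallel {Γ : E → E →L[ℝ] E →L[ℝ] E} {J : E → E →L[ℝ] E} {p : E}
    (hΓ : DifferentiableAt ℝ Γ p) (hJ : ContDiffAt ℝ 2 J p)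
    (hpar : ∀ᶠ q in 𝓝 p, ∀ v w, fderiv ℝ J q v w = J q (Γ q w v) - Γ q (J q w) v) (x y z : E) :
    curvEnd Γ p y (J p z) x = J p (curvEnd Γ p y z x) := by
  have hJd : HasFDerivAt J (fderiv ℝ J p) p := (hJ.differentiableAt two_ne_zero).hasFDerivAt
  have hJ2 : HasFDerivAt (fderiv ℝ J) (fderiv ℝ (fderiv ℝ J) p) p :=
    ((hJ.fderiv_right (m := 1) le_rfl).differentiableAt one_ne_zero).hasFDerivAt
  have hp := hpar.self_of_nhds
  have key : ∀ x y z : E, fderiv ℝ (fderiv ℝ J) p x y z =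
      J p (fderiv ℝ Γ p x z y) + fderiv ℝ J p x (Γ p z y) - Γ p (fderiv ℝ J p x z) y
        - fderiv ℝ Γ p x (J p z) y := by
    intro x y z
    have h1 := (hJ2.clm_apply (hasFDerivAt_const y p)).clm_apply (hasFDerivAt_const z p)
    have h2 := (hJd.clm_apply ((hΓ.hasFDerivAt.clm_apply (hasFDerivAt_const z p)).clm_apply
      (hasFDerivAt_const y p))).sub
        ((hΓ.hasFDerivAt.clm_apply (hJd.clm_apply (hasFDerivAt_const z p))).clm_apply
          (hasFDerivAt_const y p))
    have h3 := h2.congr_of_eventuallyEq (f₁ := fun q ↦ fderiv ℝ J q y z)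
      (hpar.mono fun q hq ↦ hq y z)
    have h4 := congrArg (fun L ↦ L x) (h1.unique h3)
    simp at h4
    rw [h4]; abel
  -- Differentiating the equation ∇J = 0 expresses the second derivative of `J` through `Γ` and its
  -- derivative; its symmetry in `x`, `y` is then exactly the commutation of R(x, y) with `J`.
  have hs : fderiv ℝ (fderiv ℝ J) p x y = fderiv ℝ (fderiv ℝ J) p y x :=
    (hJ.isSymmSndFDerivAt (by simp)).eq _ _
  have h := congrArg (fun L ↦ L z) hs
  simp only [key, hp, map_sub, sub_apply] at h
  simp only [curvEnd_apply, map_sub, map_add]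
  rw [← sub_eq_zero] at h ⊢
  rw [← neg_eq_zero, ← h]
  abel

set_option synthInstance.maxHeartbeats 200000 in
/-- The curvature of a metric connection is skew-symmetric. -/
lemma curvEnd_metric {Γ : E → E →L[ℝ] E →L[ℝ] E} {g : E → E →L[ℝ] E →L[ℝ] ℝ} {p : E}
    (hΓ : DifferentiableAt ℝ Γ p) (hg : ContDiffAt ℝ 2 g p)
    (hmet : ∀ᶠ q in 𝓝 p, ∀ v a b, fderiv ℝ g q v a b = g q (Γ q a v) b + g q a (Γ q b v))
    (x y a b : E) :
    g p (curvEnd Γ p y a x) b + g p a (curvEnd Γ p y b x) = 0 := by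
  have hgd : HasFDerivAt g (fderiv ℝ g p) p := (hg.differentiableAt two_ne_zero).hasFDerivAt
  have hp := hmet.self_of_nhds
  -- For constant `a`, `b`, metric compatibility computes the second derivative of g(a, b); its
  -- antisymmetric part, which vanishes, is g(R(x, y)a, b) + g(a, R(x, y)b).
  let f : E → ℝ := fun q ↦ g q a b
  have hf : ContDiffAt ℝ 2 f p := (hg.clm_apply contDiffAt_const).clm_apply contDiffAt_const
  have hf2 : HasFDerivAt (fderiv ℝ f) (fderiv ℝ (fderiv ℝ f) p) p :=
    ((hf.fderiv_right (m := 1) le_rfl).differentiableAt one_ne_zero).hasFDerivAt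
  have hdf : ∀ᶠ q in 𝓝 p, ∀ v, fderiv ℝ f q v = g q (Γ q a v) b + g q a (Γ q b v) := by
    filter_upwards [hmet, hg.eventually (by simp)] with q hq hgq v
    rw [← hq]
    have := ((hgq.differentiableAt two_ne_zero).hasFDerivAt.clm_apply
      (hasFDerivAt_const a q)).clm_apply (hasFDerivAt_const b q)
    rw [this.fderiv]
    simp
  have key : ∀ x y : E, fderiv ℝ (fderiv ℝ f) p x y =
      g p (fderiv ℝ Γ p x a y) b + fderiv ℝ g p x (Γ p a y) b + g p a (fderiv ℝ Γ p x b y)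
        + fderiv ℝ g p x a (Γ p b y) := by
    intro x y
    have h1 := hf2.clm_apply (hasFDerivAt_const y p)
    have h2 := ((hgd.clm_apply ((hΓ.hasFDerivAt.clm_apply (hasFDerivAt_const a p)).clm_apply
      (hasFDerivAt_const y p))).clm_apply (hasFDerivAt_const b p)).add
        ((hgd.clm_apply (hasFDerivAt_const a p)).clm_apply
        ((hΓ.hasFDerivAt.clm_apply (hasFDerivAt_const b p)).clm_apply
      (hasFDerivAt_const y p)))
    have h3 := h2.congr_of_eventuallyEq (f₁ := fun q ↦ fderiv ℝ f q y)
      (hdf.mono fun q hq ↦ hq y)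
    have h4 := congrArg (fun L ↦ L x) (h1.unique h3)
    simp at h4
    rw [h4]; ring
  have h : fderiv ℝ (fderiv ℝ f) p x y = fderiv ℝ (fderiv ℝ f) p y x :=
    (hf.isSymmSndFDerivAt (by simp)).eq _ _
  simp only [key, hp] at h
  simp only [curvEnd_apply, map_sub, map_add, sub_apply, add_apply]
  linear_combination h

/-! ### Traces and the Bochner divergence formula. -/

section Trace

variable [FiniteDimensional ℝ E]

variable (E) in
/-- The trace on continuous endomorphisms, as a continuous linear form. -/
def traceL : (E →L[ℝ] E) →L[ℝ] ℝ :=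
  LinearMap.toContinuousLinearMap (LinearMap.trace ℝ E ∘ₗ ContinuousLinearMap.coeLM ℝ)

lemma traceL_apply (A : E →L[ℝ] E) : traceL E A = LinearMap.trace ℝ E (A : E →ₗ[ℝ] E) := rfl

lemma traceL_comp_comm (A B : E →L[ℝ] E) : traceL E (A ∘L B) = traceL E (B ∘L A) := by
  simp only [traceL_apply]
  exact LinearMap.trace_mul_comm ℝ (A : E →ₗ[ℝ] E) (B : E →ₗ[ℝ] E)

lemma traceL_smulRight (f : E →L[ℝ] ℝ) (y : E) : traceL E (f.smulRight y) = f y := by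
  rw [traceL_apply]
  have : ((f.smulRight y : E →L[ℝ] E) : E →ₗ[ℝ] E) = (f : E →ₗ[ℝ] ℝ).smulRight y := rfl
  rw [this, LinearMap.trace_smulRight]; rfl

lemma traceL_id : traceL E (ContinuousLinearMap.id ℝ E) = Module.finrank ℝ E := by
  rw [traceL_apply]; exact LinearMap.trace_id ℝ E

/-- The vector field `∇_Y Y - (div Y) Y`. -/
def bochnerField (Γ : E → E →L[ℝ] E →L[ℝ] E) (Y : E → E) (p : E) : E :=
  covDeriv Γ Y p (Y p) - traceL E (covDeriv Γ Y p) • Y p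

/-- With N = ∇Y, differentiating N(Y) yields N² plus (∇_x N)(Y). The Ricci identity replaces (∇_x
N)(Y) by (∇_Y N)(x) + R(x, Y)Y, and the trace of ∇_Y N cancels the derivative of div Y. The trace of
x ↦ R(x, Y)Y is Ric(Y, Y). -/
lemma trace_covDeriv_bochnerField {Γ : E → E →L[ℝ] E →L[ℝ] E} {Y : E → E} {p : E}
    (hΓ : DifferentiableAt ℝ Γ p) (hsymm : ∀ v w, Γ p v w = Γ p w v) (hY : ContDiffAt ℝ 2 Y p) :
    traceL E (covDeriv Γ (bochnerField Γ Y) p) =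
      traceL E (covDeriv Γ Y p ∘L covDeriv Γ Y p) - traceL E (covDeriv Γ Y p) ^ 2
        + traceL E (curvEnd Γ p (Y p) (Y p)) := by
  set N := covDeriv Γ Y with hN
  have hYd : HasFDerivAt Y (fderiv ℝ Y p) p := (hY.differentiableAt two_ne_zero).hasFDerivAt
  have hNd : HasFDerivAt N (fderiv ℝ N p) p :=
    (hasFDerivAt_covDeriv hΓ hY).differentiableAt.hasFDerivAt
  have hB : HasFDerivAt (bochnerField Γ Y)
      ((N p ∘L fderiv ℝ Y p + (fderiv ℝ N p).flip (Y p)) -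
        (traceL E (N p) • fderiv ℝ Y p + (traceL E ∘L fderiv ℝ N p).smulRight (Y p))) p :=
    (hNd.clm_apply hYd).sub (((traceL E).hasFDerivAt.comp p hNd).smul hYd)
  have hcov : covDeriv Γ (bochnerField Γ Y) p =
      N p ∘L (N p - Γ p (Y p)) + (fderiv ℝ N p).flip (Y p) -
        traceL E (N p) • N p - (traceL E ∘L fderiv ℝ N p).smulRight (Y p)
        + Γ p (N p (Y p)) := by
    ext x
    simp only [covDeriv, hB.fderiv, bochnerField, hN]
    simp
    module
  -- The Ricci identity, with the Christoffel terms of the derivative of N written out; symmetry of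
  -- the second derivative of `Y` removes its second-order part.
  have hcurv : (fderiv ℝ N p).flip (Y p) - fderiv ℝ N p (Y p) =
      curvEnd Γ p (Y p) (Y p) + Γ p (Y p) ∘L N p - Γ p (N p (Y p)) := by
    ext x
    have hs : fderiv ℝ (fderiv ℝ Y) p x (Y p) = fderiv ℝ (fderiv ℝ Y) p (Y p) x :=
      (hY.isSymmSndFDerivAt (by simp)).eq _ _
    simp only [sub_apply, ContinuousLinearMap.flip_apply, add_apply,
      fderiv_covDeriv_apply hΓ hY, hN, curvEnd_apply, hs, ContinuousLinearMap.comp_apply,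
      hsymm (Y p) (covDeriv Γ Y p x)]
    simp only [covDeriv, add_apply, map_add]
    abel
  have h1 := congrArg (traceL E) hcov
  have h2 := congrArg (traceL E) hcurv
  simp only [map_sub, map_add, ContinuousLinearMap.comp_sub, map_smul, traceL_smulRight,
    smul_eq_mul, ContinuousLinearMap.comp_apply] at h1 h2
  rw [h1, traceL_comp_comm (N p) (Γ p (Y p))]
  linear_combination h2

end Trace

end ChartCalculus

/-! ### Curvature symmetries of a Kähler metric in a chart. -/

section KaehlerChart

variable {E : Type*} [NormedAddCommGroup E] [NormedSpace ℝ E]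

/-- A Kähler structure in a chart: a metric `g`, the Christoffel symbols `Γ` of its Levi-Civita
connection and a parallel orthogonal complex structure `J` on an open subset `Ω` of `E`. -/
structure IsKaehlerChart (Ω : Set E) (g : E → E →L[ℝ] E →L[ℝ] ℝ) (Γ : E → E →L[ℝ] E →L[ℝ] E)
    (J : E → E →L[ℝ] E) : Prop where
  isOpen : IsOpen Ω
  contDiffOn_metric : ContDiffOn ℝ ∞ g Ω
  contDiffOn_christoffel : ContDiffOn ℝ ∞ Γ Ω
  contDiffOn_complex : ContDiffOn ℝ ∞ J Ω
  metric_symm : ∀ q ∈ Ω, ∀ v w, g q v w = g q w v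
  metric_pos : ∀ q ∈ Ω, ∀ v, v ≠ 0 → 0 < g q v v
  christoffel_symm : ∀ q ∈ Ω, ∀ v w, Γ q v w = Γ q w v
  metric_parallel : ∀ q ∈ Ω, ∀ v a b,
    fderiv ℝ g q v a b = g q (Γ q a v) b + g q a (Γ q b v)
  complex_parallel : ∀ q ∈ Ω, ∀ v w, fderiv ℝ J q v w = J q (Γ q w v) - Γ q (J q w) v
  complex_sq : ∀ q ∈ Ω, ∀ v, J q (J q v) = -v
  complex_orthogonal : ∀ q ∈ Ω, ∀ v w, g q (J q v) (J q w) = g q v w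

/-- The pair symmetry of algebraic curvature tensors. -/
lemma pair_symm_of_bianchi {α : Type*} (T : α → α → α → α → ℝ)
    (h₁ : ∀ x y z w, T x y z w = - T y x z w) (h₂ : ∀ x y z w, T x y z w = - T x y w z)
    (h₃ : ∀ x y z w, T x y z w + T y z x w + T z x y w = 0) (x y z w : α) :
    T x y z w = T z w x y := by
  linarith [h₃ x y z w, h₃ y z w x, h₃ z w x y, h₃ w x y z,
    h₁ x y z w, h₁ y z x w, h₁ z x y w, h₁ y z w x, h₁ z w y x, h₁ w y z x,
    h₁ z w x y, h₁ w x z y, h₁ x z w y, h₁ w x y z, h₁ x y w z, h₁ y w x z,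
    h₂ x y z w, h₂ y z x w, h₂ z x y w, h₂ y z w x, h₂ z w y x, h₂ w y z x,
    h₂ z w x y, h₂ w x z y, h₂ x z w y, h₂ w x y z, h₂ x y w z, h₂ y w x z]

namespace IsKaehlerChart

variable {Ω : Set E} {g : E → E →L[ℝ] E →L[ℝ] ℝ} {Γ : E → E →L[ℝ] E →L[ℝ] E}
  {J : E → E →L[ℝ] E} {p : E}

lemma mem_nhds (h : IsKaehlerChart Ω g Γ J) (hp : p ∈ Ω) : Ω ∈ 𝓝 p := h.isOpen.mem_nhds hp

lemma differentiableAt_christoffel (h : IsKaehlerChart Ω g Γ J) (hp : p ∈ Ω) :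
    DifferentiableAt ℝ Γ p :=
  (h.contDiffOn_christoffel.contDiffAt (h.mem_nhds hp)).differentiableAt (by simp)

lemma contDiffAt_metric (h : IsKaehlerChart Ω g Γ J) (hp : p ∈ Ω) : ContDiffAt ℝ 2 g p :=
  (h.contDiffOn_metric.contDiffAt (h.mem_nhds hp)).of_le (ENat.LEInfty.out)

lemma contDiffAt_complex (h : IsKaehlerChart Ω g Γ J) (hp : p ∈ Ω) : ContDiffAt ℝ 2 J p :=
  (h.contDiffOn_complex.contDiffAt (h.mem_nhds hp)).of_le (ENat.LEInfty.out)

lemma metric_nondegenerate (h : IsKaehlerChart Ω g Γ J) (hp : p ∈ Ω) {v : E}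
    (hv : ∀ w, g p v w = 0) : v = 0 := by
  by_contra hne
  exact (h.metric_pos p hp v hne).ne' (hv v)

lemma complex_skew (h : IsKaehlerChart Ω g Γ J) (hp : p ∈ Ω) (v w : E) :
    g p (J p v) w = - g p v (J p w) := by
  have := h.complex_orthogonal p hp (J p v) w
  rw [h.complex_sq p hp] at this
  rw [← this, map_neg, neg_apply]

lemma metric_curvEnd_pair_symm (h : IsKaehlerChart Ω g Γ J) (hp : p ∈ Ω) (x y z w : E) :
    g p (curvEnd Γ p y z x) w = g p (curvEnd Γ p w x z) y := by
  have hsy := h.metric_symm p hp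
  have hev : ∀ {P : E → Prop}, (∀ q ∈ Ω, P q) → ∀ᶠ q in 𝓝 p, P q := fun hP ↦
    Filter.mem_of_superset (h.mem_nhds hp) hP
  refine pair_symm_of_bianchi (fun x y z w ↦ g p (curvEnd Γ p y z x) w) ?_ ?_ ?_ x y z w
  · intro x y z w
    rw [curvEnd_swap, map_neg, neg_apply]
  · intro x y z w
    have := curvEnd_metric (h.differentiableAt_christoffel hp) (h.contDiffAt_metric hp)
      (hev h.metric_parallel) x y z w
    rw [hsy z] at this
    linarith
  · intro x y z w
    have := curvEnd_bianchi (h.differentiableAt_christoffel hp) (hev h.christoffel_symm) x y z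
    have := congrArg (fun v ↦ g p v w) this
    simpa using this

/-- Pair symmetry moves the two `J`'s from the 2-form slots to the endomorphism slots, where
curvature commutes with `J` and `J` is orthogonal. -/
lemma curvEnd_complex_complex (h : IsKaehlerChart Ω g Γ J) (hp : p ∈ Ω) (x y z : E) :
    curvEnd Γ p (J p y) z (J p x) = curvEnd Γ p y z x := by
  have hev : ∀ {P : E → Prop}, (∀ q ∈ Ω, P q) → ∀ᶠ q in 𝓝 p, P q := fun hP ↦
    Filter.mem_of_superset (h.mem_nhds hp) hP
  rw [← sub_eq_zero]
  refine h.metric_nondegenerate hp fun w ↦ ?_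
  rw [map_sub, sub_apply, h.metric_curvEnd_pair_symm hp, curvEnd_parallel
    (h.differentiableAt_christoffel hp) (h.contDiffAt_complex hp) (hev h.complex_parallel),
    h.complex_orthogonal p hp, ← h.metric_curvEnd_pair_symm hp, sub_self]

lemma covDeriv_complex {ξ : E → E} (h : IsKaehlerChart Ω g Γ J) (hξ : ContDiffOn ℝ ∞ ξ Ω)
    (hp : p ∈ Ω) :
    covDeriv Γ (fun q ↦ J q (ξ q)) p = J p ∘L covDeriv Γ ξ p := by
  have hJd : HasFDerivAt J (fderiv ℝ J p) p :=
    ((h.contDiffAt_complex hp).differentiableAt two_ne_zero).hasFDerivAt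
  have hξd : HasFDerivAt ξ (fderiv ℝ ξ p) p :=
    ((hξ.contDiffAt (h.mem_nhds hp)).differentiableAt (by simp)).hasFDerivAt
  ext v
  rw [covDeriv, (hJd.clm_apply hξd).fderiv]
  simp [covDeriv, h.complex_parallel p hp]
  abel

variable [FiniteDimensional ℝ E]

/-- The Ricci form of a Kähler metric is `J`-invariant. -/
lemma trace_curvEnd_complex (h : IsKaehlerChart Ω g Γ J) (hp : p ∈ Ω) (y : E) :
    traceL E (curvEnd Γ p (J p y) (J p y)) = traceL E (curvEnd Γ p y y) := by
  have hev : ∀ {P : E → Prop}, (∀ q ∈ Ω, P q) → ∀ᶠ q in 𝓝 p, P q := fun hP ↦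
    Filter.mem_of_superset (h.mem_nhds hp) hP
  -- One `J` comes out because R commutes with it, passes around the trace, and is absorbed through
  -- R(Jx, Jy) = R(x, y).
  have h1 : curvEnd Γ p (J p y) (J p y) = J p ∘L curvEnd Γ p (J p y) y := by
    ext x
    rw [curvEnd_parallel (h.differentiableAt_christoffel hp) (h.contDiffAt_complex hp)
      (hev h.complex_parallel)]
    rfl
  have h2 : curvEnd Γ p (J p y) y ∘L J p = curvEnd Γ p y y := by
    ext x
    exact h.curvEnd_complex_complex hp x y y
  rw [h1, traceL_comp_comm, h2]

end IsKaehlerChart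

/-- An endomorphism which is skew for a scalar product has trace zero. -/
lemma traceL_eq_zero_of_skew [FiniteDimensional ℝ E] (g : E →L[ℝ] E →L[ℝ] ℝ) (A : E →L[ℝ] E)
    (hsymm : ∀ v w, g v w = g w v) (hpos : ∀ v, v ≠ 0 → 0 < g v v) (hA : ∀ v, g (A v) v = 0) :
    traceL E A = 0 := by
  let B : LinearMap.BilinForm ℝ E := LinearMap.mk₂ ℝ (fun v w ↦ g v w) (by simp) (by simp)
    (by simp) (by simp)
  -- In a `g`-orthogonal basis the i-th diagonal entry of `A` is g(A vᵢ, vᵢ) / g(vᵢ, vᵢ).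
  obtain ⟨v, hv⟩ := LinearMap.BilinForm.exists_orthogonal_basis (B := B)
    ⟨fun x y ↦ by simpa [B] using hsymm x y⟩
  rw [traceL_apply, LinearMap.trace_eq_matrix_trace ℝ v, Matrix.trace]
  refine Finset.sum_eq_zero fun i _ ↦ ?_
  rw [Matrix.diag_apply, LinearMap.toMatrix_apply]
  have h1 := hA (v i)
  rw [← v.sum_repr (A (v i))] at h1
  simp only [map_sum, map_smul, sum_apply, smul_apply, smul_eq_mul] at h1
  rw [Finset.sum_eq_single i] at h1
  · exact (mul_eq_zero.mp h1).resolve_right (hpos _ (v.ne_zero i)).ne'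
  · intro j _ hj
    have : g (v j) (v i) = 0 := hv hj
    rw [this, mul_zero]
  · simp

/-! ### The Bochner difference of the unit field and its image under J. -/

section Umbilic

lemma contDiffOn_covDeriv {Ω : Set E} (hΩ : IsOpen Ω) {Γ : E → E →L[ℝ] E →L[ℝ] E} {Y : E → E}
    (hΓ : ContDiffOn ℝ ∞ Γ Ω) (hY : ContDiffOn ℝ ∞ Y Ω) : ContDiffOn ℝ ∞ (covDeriv Γ Y) Ω :=
  (hY.fderiv_of_isOpen hΩ (by simp)).add (hΓ.clm_apply hY)

variable [FiniteDimensional ℝ E]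

lemma contDiffOn_bochnerField {Ω : Set E} (hΩ : IsOpen Ω) {Γ : E → E →L[ℝ] E →L[ℝ] E}
    {Y : E → E} (hΓ : ContDiffOn ℝ ∞ Γ Ω) (hY : ContDiffOn ℝ ∞ Y Ω) :
    ContDiffOn ℝ ∞ (bochnerField Γ Y) Ω :=
  ((contDiffOn_covDeriv hΩ hΓ hY).clm_apply hY).sub
    (((traceL E).contDiff.comp_contDiffOn (contDiffOn_covDeriv hΩ hΓ hY)).smul hY)

/-- The vector field `(∇_ξ ξ - (div ξ) ξ) - (∇_{Jξ} Jξ - (div Jξ) Jξ)`. -/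
def bochnerDifference (Γ : E → E →L[ℝ] E →L[ℝ] E) (J : E → E →L[ℝ] E) (ξ : E → E) (p : E) : E :=
  bochnerField Γ ξ p - bochnerField Γ (fun q ↦ J q (ξ q)) p

namespace IsKaehlerChart

variable {Ω : Set E} {g : E → E →L[ℝ] E →L[ℝ] ℝ} {Γ : E → E →L[ℝ] E →L[ℝ] E}
  {J : E → E →L[ℝ] E} {p : E} {ξ Z : E → E}

lemma contDiffOn_bochnerDifference
    (h : IsKaehlerChart Ω g Γ J) (hξ : ContDiffOn ℝ ∞ ξ Ω) :
    ContDiffOn ℝ ∞ (bochnerDifference Γ J ξ) Ω :=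
  (contDiffOn_bochnerField h.isOpen h.contDiffOn_christoffel hξ).sub
    (contDiffOn_bochnerField h.isOpen h.contDiffOn_christoffel
      (h.contDiffOn_complex.clm_apply hξ))

lemma complex_trace (h : IsKaehlerChart Ω g Γ J) (hp : p ∈ Ω) : traceL E (J p) = 0 := by
  refine traceL_eq_zero_of_skew (g p) (J p) (h.metric_symm p hp) (h.metric_pos p hp) fun v ↦ ?_
  have := h.complex_skew hp v v
  rw [h.metric_symm p hp v] at this
  linarith

/-- With a = g(Z, ξ), the formula for ∇ξ gives ∇_ξ ξ = Z - aξ and div ξ = -(n - 1)a. Since J is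
parallel, orthogonal and trace-free, ∇_{Jξ} Jξ = aξ and div Jξ = -g(Z, Jξ). The resulting expression
is quadratic in ξ, which later allows local fields to be glued. -/
lemma bochnerDifference_eq
    (h : IsKaehlerChart Ω g Γ J) (hξ : ContDiffOn ℝ ∞ ξ Ω)
    (hunit : ∀ q ∈ Ω, g q (ξ q) (ξ q) = 1)
    (hcov : ∀ q ∈ Ω, ∀ v, covDeriv Γ ξ q v = -(g q (Z q) (ξ q)) • v + g q v (ξ q) • Z q)
    (hp : p ∈ Ω) :
    bochnerDifference Γ J ξ p = Z p + (((Module.finrank ℝ E : ℝ) - 3) * g p (Z p) (ξ p)) • ξ p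
      - g p (Z p) (J p (ξ p)) • J p (ξ p) := by
  have hN : covDeriv Γ ξ p = -(g p (Z p) (ξ p)) • ContinuousLinearMap.id ℝ E
      + ((g p).flip (ξ p)).smulRight (Z p) := by
    ext v; simp [hcov p hp]
  have hu : g p (J p (ξ p)) (ξ p) = 0 := by
    have := h.complex_skew hp (ξ p) (ξ p)
    rw [h.metric_symm p hp (ξ p)] at this
    linarith
  have htr : traceL E (covDeriv Γ ξ p) =
      - (g p (Z p) (ξ p)) * Module.finrank ℝ E + g p (Z p) (ξ p) := by
    rw [hN, map_add, map_smul, traceL_id, traceL_smulRight]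
    simp
  have htr' : traceL E (J p ∘L covDeriv Γ ξ p) = - g p (Z p) (J p (ξ p)) := by
    have : J p ∘L covDeriv Γ ξ p = -(g p (Z p) (ξ p)) • J p
      + ((g p).flip (ξ p)).smulRight (J p (Z p)) := by
      ext v; simp [hcov p hp]
    rw [this, map_add, map_smul, traceL_smulRight, h.complex_trace hp]
    simp [h.complex_skew hp]
  rw [bochnerDifference, bochnerField, bochnerField, h.covDeriv_complex hξ hp, htr, htr',
    ContinuousLinearMap.comp_apply, hcov p hp, hcov p hp, hu, hunit p hp]
  simp only [map_smul, h.complex_sq p hp, zero_smul, add_zero]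
  module

/-- The Ricci terms cancel by J-invariance. With a = g(Z, ξ), the field ξ contributes (n - 1)a² - (n
- 1)²a². For Jξ the two squares of g(Z, Jξ) cancel, leaving (2 - n)a². The difference is -(n -
2)²a². -/
lemma trace_covDeriv_bochnerDifference
    (h : IsKaehlerChart Ω g Γ J) (hξ : ContDiffOn ℝ ∞ ξ Ω)
    (hcov : ∀ q ∈ Ω, ∀ v, covDeriv Γ ξ q v = -(g q (Z q) (ξ q)) • v + g q v (ξ q) • Z q)
    (hp : p ∈ Ω) :
    traceL E (covDeriv Γ (bochnerDifference Γ J ξ) p) =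
      -(((Module.finrank ℝ E : ℝ) - 2) ^ 2 * g p (Z p) (ξ p) ^ 2) := by
  have hΩ := h.mem_nhds hp
  have two_le : (2 : WithTop ℕ∞) ≤ ∞ := ENat.LEInfty.out
  have hξJ := h.contDiffOn_complex.clm_apply hξ
  have hB := ((contDiffOn_bochnerField h.isOpen h.contDiffOn_christoffel hξ).contDiffAt
    hΩ).differentiableAt (by simp)
  have hB' := ((contDiffOn_bochnerField h.isOpen h.contDiffOn_christoffel hξJ).contDiffAt
    hΩ).differentiableAt (by simp)
  have hsub : covDeriv Γ (bochnerDifference Γ J ξ) p = covDeriv Γ (bochnerField Γ ξ) p -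
      covDeriv Γ (bochnerField Γ (fun q ↦ J q (ξ q))) p := by
    have : bochnerDifference Γ J ξ = bochnerField Γ ξ - bochnerField Γ (fun q ↦ J q (ξ q)) := rfl
    rw [this, covDeriv, fderiv_sub hB hB', Pi.sub_apply, map_sub, covDeriv, covDeriv]
    abel
  rw [hsub, map_sub, trace_covDeriv_bochnerField (h.differentiableAt_christoffel hp)
    (h.christoffel_symm p hp) ((hξ.contDiffAt hΩ).of_le two_le),
    trace_covDeriv_bochnerField (h.differentiableAt_christoffel hp)
    (h.christoffel_symm p hp) ((hξJ.contDiffAt hΩ).of_le two_le),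
    h.trace_curvEnd_complex hp, h.covDeriv_complex hξ hp]
  have hN : covDeriv Γ ξ p = -(g p (Z p) (ξ p)) • ContinuousLinearMap.id ℝ E
      + ((g p).flip (ξ p)).smulRight (Z p) := by
    ext v; simp [hcov p hp]
  have hJN : J p ∘L covDeriv Γ ξ p = -(g p (Z p) (ξ p)) • J p
      + ((g p).flip (ξ p)).smulRight (J p (Z p)) := by
    ext v; simp [hcov p hp]
  set a := g p (Z p) (ξ p) with ha
  have hNN : covDeriv Γ ξ p ∘L covDeriv Γ ξ p = (a ^ 2) • ContinuousLinearMap.id ℝ E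
      + (-a) • ((g p).flip (ξ p)).smulRight (Z p) := by
    ext v
    simp only [ContinuousLinearMap.comp_apply, hcov p hp, ← ha, map_add, map_smul, add_apply,
      smul_apply, ContinuousLinearMap.smulRight_apply, ContinuousLinearMap.flip_apply,
      ContinuousLinearMap.id_apply, smul_eq_mul]
    module
  have hJNJN : (J p ∘L covDeriv Γ ξ p) ∘L (J p ∘L covDeriv Γ ξ p) =
      (-(a ^ 2)) • ContinuousLinearMap.id ℝ E + a • ((g p).flip (ξ p)).smulRight (Z p)
      + a • ((g p).flip (J p (ξ p))).smulRight (J p (Z p))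
      + g p (J p (Z p)) (ξ p) • ((g p).flip (ξ p)).smulRight (J p (Z p)) := by
    ext v
    have hs : g p (J p v) (ξ p) = - g p v (J p (ξ p)) := h.complex_skew hp _ _
    rw [hJN]
    simp only [ContinuousLinearMap.comp_apply, map_add, map_smul, add_apply,
      smul_apply, ContinuousLinearMap.smulRight_apply, ContinuousLinearMap.flip_apply,
      ContinuousLinearMap.id_apply, h.complex_sq p hp, hs]
    module
  rw [hNN, hJNJN, hJN, hN]
  simp only [map_add, map_smul, traceL_smulRight, traceL_id, h.complex_trace hp,
    ContinuousLinearMap.flip_apply, smul_eq_mul, h.complex_orthogonal p hp, ← ha]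
  ring

end IsKaehlerChart

end Umbilic

end KaehlerChart

/-! ### The Riemannian density √det g. -/

section Density

variable {E : Type*} [NormedAddCommGroup E] [NormedSpace ℝ E] {ι : Type*} [Fintype ι]
  [DecidableEq ι]

/-- Jacobi's formula for the derivative of the determinant. -/
lemma hasFDerivAt_det {M : E → Matrix ι ι ℝ} {M' : ι → ι → E →L[ℝ] ℝ} {p : E}
    (h : ∀ i j, HasFDerivAt (fun q ↦ M q i j) (M' i j) p) :
    HasFDerivAt (fun q ↦ (M q).det) (∑ k, ∑ l, (M p).adjugate k l • M' l k) p := by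
  have h1 : HasFDerivAt (fun q ↦ (M q).det) (∑ σ : Equiv.Perm ι, ((Equiv.Perm.sign σ : ℤ) : ℝ) •
      ∑ k, (∏ j ∈ Finset.univ.erase k, M p (σ j) j) • M' (σ k) k) p := by
    simp only [Matrix.det_apply']
    refine HasFDerivAt.fun_sum fun σ _ ↦ HasFDerivAt.const_mul ?_ _
    exact HasFDerivAt.finsetProd fun k _ ↦ h (σ k) k
  convert h1 using 1
  ext v
  -- Cramer's rule: this sum is the determinant with its k-th column replaced by the derivative, and
  -- so the k-th group of terms in the product rule for the Leibniz expansion.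
  have h2 : ∀ k, ∑ l, (M p).adjugate k l * M' l k v =
      ∑ σ : Equiv.Perm ι, ((Equiv.Perm.sign σ : ℤ) : ℝ) *
        ((∏ j ∈ Finset.univ.erase k, M p (σ j) j) * M' (σ k) k v) := by
    intro k
    have : ∑ l, (M p).adjugate k l * M' l k v = ((M p).updateCol k (fun l ↦ M' l k v)).det := by
      rw [← Matrix.cramer_apply, Matrix.cramer_eq_adjugate_mulVec]
      rfl
    rw [this, Matrix.det_apply']
    refine Finset.sum_congr rfl fun σ _ ↦ ?_
    rw [← Finset.prod_erase_mul _ _ (Finset.mem_univ k), Matrix.updateCol_self]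
    congr 2
    refine Finset.prod_congr rfl fun j hj ↦ ?_
    rw [Matrix.updateCol_ne (Finset.ne_of_mem_erase hj)]
  simp only [sum_apply, smul_apply, smul_eq_mul, h2, Finset.mul_sum]
  rw [Finset.sum_comm]

/-- The Gram matrix of a bilinear form in a basis. -/
def gramMatrix (b : Module.Basis ι ℝ E) (g : E →L[ℝ] E →L[ℝ] ℝ) : Matrix ι ι ℝ :=
  Matrix.of fun i j ↦ g (b i) (b j)

/-- The Riemannian density of a metric in a basis. -/
def density (b : Module.Basis ι ℝ E) (g : E →L[ℝ] E →L[ℝ] ℝ) : ℝ := √(gramMatrix b g).det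

lemma gramMatrix_det_pos (b : Module.Basis ι ℝ E) {g : E →L[ℝ] E →L[ℝ] ℝ}
    (hsymm : ∀ v w, g v w = g w v) (hpos : ∀ v, v ≠ 0 → 0 < g v v) :
    0 < (gramMatrix b g).det := by
  refine Matrix.PosDef.det_pos (Matrix.PosDef.of_dotProduct_mulVec_pos ?_ fun x hx ↦ ?_)
  · ext i j
    simp [gramMatrix, hsymm (b i)]
  · have hne : ∑ i, x i • b i ≠ 0 := by
      intro h0
      exact hx (funext fun i ↦ Fintype.linearIndependent_iff.mp b.linearIndependent x h0 i)
    suffices key : star x ⬝ᵥ (gramMatrix b g).mulVec x = g (∑ i, x i • b i) (∑ i, x i • b i) by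
      rw [key]
      exact hpos _ hne
    simp only [dotProduct, Matrix.mulVec, gramMatrix, map_sum, map_smul, sum_apply, smul_apply,
      Matrix.of_apply, smul_eq_mul, star_trivial, Finset.mul_sum]
    rw [Finset.sum_comm]
    refine Finset.sum_congr rfl fun i _ ↦ Finset.sum_congr rfl fun j _ ↦ by ring

lemma density_pos (b : Module.Basis ι ℝ E) {g : E →L[ℝ] E →L[ℝ] ℝ}
    (hsymm : ∀ v w, g v w = g w v) (hpos : ∀ v, v ≠ 0 → 0 < g v v) : 0 < density b g :=
  Real.sqrt_pos.mpr (gramMatrix_det_pos b hsymm hpos)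

/-- The density transforms by the determinant under pull-back. -/
lemma density_bilinearComp (b : Module.Basis ι ℝ E) (g : E →L[ℝ] E →L[ℝ] ℝ) (A : E →L[ℝ] E) :
    density b (g.bilinearComp A A) = |A.det| * density b g := by
  have h : gramMatrix b (g.bilinearComp A A) =
      (LinearMap.toMatrix b b A).transpose * gramMatrix b g * LinearMap.toMatrix b b A := by
    ext i j
    simp only [gramMatrix, Matrix.of_apply, ContinuousLinearMap.bilinearComp_apply,
      Matrix.mul_apply, Matrix.transpose_apply, LinearMap.toMatrix_apply,
      ContinuousLinearMap.coe_coe]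
    conv_lhs => rw [← b.sum_repr (A (b i)), ← b.sum_repr (A (b j))]
    simp only [map_sum, map_smul, sum_apply, smul_apply, smul_eq_mul, Finset.mul_sum,
      Finset.sum_mul]
    refine Finset.sum_congr rfl fun k _ ↦ Finset.sum_congr rfl fun l _ ↦ by ring
  rw [density, density, h, Matrix.det_mul, Matrix.det_mul, Matrix.det_transpose,
    LinearMap.det_toMatrix]
  have : LinearMap.det (A : E →ₗ[ℝ] E) * (gramMatrix b g).det * LinearMap.det (A : E →ₗ[ℝ] E) =
    A.det ^ 2 * (gramMatrix b g).det := by rw [ContinuousLinearMap.det]; ring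
  rw [this, Real.sqrt_mul (sq_nonneg _), Real.sqrt_sq_eq_abs]

lemma contDiffOn_density (b : Module.Basis ι ℝ E) {Ω : Set E} {g : E → E →L[ℝ] E →L[ℝ] ℝ}
    (hg : ContDiffOn ℝ ∞ g Ω)
    (hsymm : ∀ q ∈ Ω, ∀ v w, g q v w = g q w v) (hpos : ∀ q ∈ Ω, ∀ v, v ≠ 0 → 0 < g q v v) :
    ContDiffOn ℝ ∞ (fun q ↦ density b (g q)) Ω := by
  refine ContDiffOn.sqrt ?_ fun q hq ↦ (gramMatrix_det_pos b (hsymm q hq) (hpos q hq)).ne'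
  simp only [Matrix.det_apply', gramMatrix, Matrix.of_apply]
  refine ContDiffOn.sum fun σ _ ↦ contDiffOn_const.mul (contDiffOn_prod fun i _ ↦ ?_)
  exact (hg.clm_apply contDiffOn_const).clm_apply contDiffOn_const

variable [FiniteDimensional ℝ E]

/-- Metric compatibility says that the Gram matrix G has derivative BᵀG + GB, with B the matrix of
`Γ(·, v)`. Jacobi's formula then gives 2 det G · tr B, and the square root halves this. -/
lemma hasFDerivAt_density (b : Module.Basis ι ℝ E) {g : E → E →L[ℝ] E →L[ℝ] ℝ}
    {Γ : E → E →L[ℝ] E →L[ℝ] E} {p : E} (hg : DifferentiableAt ℝ g p)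
    (hsymm : ∀ v w, g p v w = g p w v) (hpos : ∀ v, v ≠ 0 → 0 < g p v v)
    (hmet : ∀ v x y, fderiv ℝ g p v x y = g p (Γ p x v) y + g p x (Γ p y v)) :
    HasFDerivAt (fun q ↦ density b (g q))
      (density b (g p) • (traceL E ∘L (Γ p).flip)) p := by
  have hdet := gramMatrix_det_pos b hsymm hpos
  have h1 : ∀ i j, HasFDerivAt (fun q ↦ gramMatrix b (g q) i j)
      (((fderiv ℝ g p).flip (b i)).flip (b j)) p := by
    intro i j
    have := (hg.hasFDerivAt.clm_apply (hasFDerivAt_const (b i) p)).clm_apply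
      (hasFDerivAt_const (b j) p)
    refine this.congr_fderiv ?_
    ext; simp
  have h2 := (hasFDerivAt_det h1).sqrt hdet.ne'
  refine h2.congr_fderiv ?_
  ext v
  set G := gramMatrix b (g p) with hG
  set B := LinearMap.toMatrix b b ((Γ p).flip v : E →L[ℝ] E) with hB
  have htr : traceL E ((Γ p).flip v) = B.trace := by
    rw [traceL_apply, LinearMap.trace_eq_matrix_trace ℝ b]
  have hM : ∀ i j, fderiv ℝ g p v (b i) (b j) = (B.transpose * G + G * B) i j := by
    intro i j
    rw [hmet]
    have hΓ : ∀ i, Γ p (b i) v = ∑ k, B k i • b k := by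
      intro i
      rw [← b.sum_repr (Γ p (b i) v)]
      simp [hB, LinearMap.toMatrix_apply]
    simp only [hΓ, map_sum, map_smul, sum_apply, smul_apply, smul_eq_mul, Matrix.add_apply,
      Matrix.mul_apply, Matrix.transpose_apply, hG, gramMatrix, Matrix.of_apply]
    congr 1
    exact Finset.sum_congr rfl fun k _ ↦ mul_comm _ _
  -- Cyclicity of the trace brings the adjugate next to G in both summands, and each contributes det
  -- G · tr B.
  have hsum : ∑ k, ∑ l, G.adjugate k l * fderiv ℝ g p v (b l) (b k) = 2 * G.det * B.trace := by
    have : ∑ k, ∑ l, G.adjugate k l * fderiv ℝ g p v (b l) (b k) =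
        (G.adjugate * (B.transpose * G + G * B)).trace := by
      simp only [Matrix.trace, Matrix.diag_apply, Matrix.mul_apply (M := G.adjugate), hM]
    rw [this, Matrix.mul_add, Matrix.trace_add, ← Matrix.mul_assoc, ← Matrix.mul_assoc,
      Matrix.adjugate_mul, Matrix.trace_mul_cycle, Matrix.mul_adjugate]
    simp
    ring
  have hs0 : √G.det ≠ 0 := (Real.sqrt_pos.mpr hdet).ne'
  simp only [smul_apply, sum_apply, ContinuousLinearMap.flip_apply, smul_eq_mul,
    ContinuousLinearMap.comp_apply, hsum, htr, density, ← hG]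
  field_simp
  rw [Real.sq_sqrt hdet.le]

end Density

/-! ### The divergence theorem in a vector space. -/

section Divergence

open MeasureTheory

variable {E : Type*} [NormedAddCommGroup E] [NormedSpace ℝ E] [FiniteDimensional ℝ E]

/-- The logarithmic derivative of the density is the trace of the Christoffel symbols, so
multiplying by the density turns the covariant divergence into the Euclidean one. Symmetry of `Γ`
identifies the two ways of contracting it. -/
lemma trace_fderiv_smul_density {ι : Type*} [Fintype ι] [DecidableEq ι] (b : Module.Basis ι ℝ E)
    {g : E → E →L[ℝ] E →L[ℝ] ℝ}
    {Γ : E → E →L[ℝ] E →L[ℝ] E} {p : E} (hg : DifferentiableAt ℝ g p)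
    (hsymm : ∀ v w, g p v w = g p w v) (hpos : ∀ v, v ≠ 0 → 0 < g p v v)
    (hΓ : ∀ v w, Γ p v w = Γ p w v)
    (hmet : ∀ v x y, fderiv ℝ g p v x y = g p (Γ p x v) y + g p x (Γ p y v))
    {ψ : E → ℝ} {V : E → E} (hψ : DifferentiableAt ℝ ψ p) (hV : DifferentiableAt ℝ V p) :
    traceL E (fderiv ℝ (fun q ↦ density b (g q) • ψ q • V q) p) =
      density b (g p) * (ψ p * traceL E (covDeriv Γ V p) + fderiv ℝ ψ p (V p)) := by
  have h := (hasFDerivAt_density b hg hsymm hpos hmet).smul (hψ.hasFDerivAt.smul hV.hasFDerivAt)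
  have h' := h.fderiv
  have e : (Γ p).flip (V p) = Γ p (V p) := by ext w; exact hΓ _ _
  rw [show (fun q ↦ density b (g q) • ψ q • V q) = ((fun q ↦ density b (g q)) • (ψ • V)) from rfl,
    h']
  simp only [map_add, map_smul, traceL_smulRight, smul_apply, ContinuousLinearMap.comp_apply,
    covDeriv, smul_eq_mul, e, Pi.smul_apply', smul_add]
  ring

variable [MeasurableSpace E] [BorelSpace E] (μ : Measure E) [μ.IsAddHaarMeasure]

/-- Integration by parts against the constant function 1. -/
lemma integral_fderiv_eq_zero_of_hasCompactSupport {f : E → ℝ} (hf : ContDiff ℝ 1 f)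
    (hc : HasCompactSupport f) (v : E) : ∫ x, fderiv ℝ f x v ∂μ = 0 := by
  have h := integral_mul_fderiv_eq_neg_fderiv_mul_of_integrable (μ := μ) (𝕜 := ℝ)
    (f := fun _ : E ↦ (1 : ℝ)) (g := f) (v := v) (by simp) ?_ ?_ ?_ ?_
  · simpa using h
  · simp only [one_mul]
    exact ((hf.continuous_fderiv one_ne_zero).clm_apply
      continuous_const).integrable_of_hasCompactSupport (hc.fderiv_apply ℝ v)
  · simpa using hf.continuous.integrable_of_hasCompactSupport hc
  · intros; fun_prop
  · intro x _
    exact hf.differentiable one_ne_zero x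

/-- The divergence theorem for vector fields with compact support in an open set. -/
lemma setIntegral_trace_fderiv_eq_zero {Ω K : Set E} (hΩ : IsOpen Ω) (hK : IsCompact K)
    (hKΩ : K ⊆ Ω) {W : E → E} (hW : ContDiffOn ℝ 1 W Ω) (hWK : ∀ x ∈ Ω \ K, W x = 0) :
    ∫ x in Ω, traceL E (fderiv ℝ W x) ∂μ = 0 := by
  classical
  -- The extension of `W` by zero is C¹ on all of `E`, since `Ω` and the complement of `K` cover
  -- `E`.
  let W' : E → E := Ω.indicator W
  have hW'0 : ∀ x ∉ K, W' x = 0 := fun x hx ↦ by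
    by_cases hxΩ : x ∈ Ω
    · simp only [W', Set.indicator_of_mem hxΩ]; exact hWK x ⟨hxΩ, hx⟩
    · simp [W', Set.indicator_of_notMem hxΩ]
  have heq : ∀ x ∈ Ω, W' =ᶠ[𝓝 x] W := fun x hx ↦
    Filter.eventuallyEq_of_mem (hΩ.mem_nhds hx) fun y hy ↦ Set.indicator_of_mem hy W
  have hW' : ContDiff ℝ 1 W' := by
    rw [contDiff_iff_contDiffAt]
    intro x
    by_cases hx : x ∈ K
    · exact (hW.contDiffAt (hΩ.mem_nhds (hKΩ hx))).congr_of_eventuallyEq (heq x (hKΩ hx))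
    · have : W' =ᶠ[𝓝 x] fun _ ↦ 0 :=
        Filter.eventuallyEq_of_mem (hK.isClosed.isOpen_compl.mem_nhds hx) fun y hy ↦ hW'0 y hy
      exact contDiffAt_const.congr_of_eventuallyEq this
  have hc : HasCompactSupport W' := HasCompactSupport.intro hK hW'0
  have h1 : ∫ x in Ω, traceL E (fderiv ℝ W x) ∂μ = ∫ x in Ω, traceL E (fderiv ℝ W' x) ∂μ :=
    setIntegral_congr_fun hΩ.measurableSet fun x hx ↦ by simp only [(heq x hx).fderiv_eq]
  have h2 : ∫ x in Ω, traceL E (fderiv ℝ W' x) ∂μ = ∫ x, traceL E (fderiv ℝ W' x) ∂μ := by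
    refine setIntegral_eq_integral_of_forall_compl_eq_zero fun x hx ↦ ?_
    have : W' =ᶠ[𝓝 x] fun _ ↦ 0 := Filter.eventuallyEq_of_mem
      (hK.isClosed.isOpen_compl.mem_nhds fun h ↦ hx (hKΩ h)) fun y hy ↦ hW'0 y hy
    rw [this.fderiv_eq]
    simp
  rw [h1, h2]
  let b := Module.finBasis ℝ E
  let c : Fin (Module.finrank ℝ E) → E →L[ℝ] ℝ := fun i ↦
    LinearMap.toContinuousLinearMap (b.coord i)
  have h3 : ∀ x, traceL E (fderiv ℝ W' x) = ∑ i, fderiv ℝ (fun y ↦ c i (W' y)) x (b i) := by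
    intro x
    rw [traceL_apply, LinearMap.trace_eq_matrix_trace ℝ b, Matrix.trace]
    refine Finset.sum_congr rfl fun i _ ↦ ?_
    have := ((c i).hasFDerivAt.comp x (hW'.differentiable one_ne_zero x).hasFDerivAt).fderiv
    rw [show (fun y ↦ c i (W' y)) = c i ∘ W' from rfl, this]
    simp [LinearMap.toMatrix_apply, c]
  have hci : ∀ i, ContDiff ℝ 1 (fun y ↦ c i (W' y)) := fun i ↦ (c i).contDiff.comp hW'
  have hcc : ∀ i, HasCompactSupport (fun y ↦ c i (W' y)) := fun i ↦
    hc.comp_left (g := c i) (map_zero _)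
  simp only [h3]
  rw [integral_finsetSum]
  · exact Finset.sum_eq_zero fun i _ ↦
      integral_fderiv_eq_zero_of_hasCompactSupport μ (hci i) (hcc i) _
  · intro i _
    exact (((hci i).continuous_fderiv one_ne_zero).clm_apply
      continuous_const).integrable_of_hasCompactSupport ((hcc i).fderiv_apply ℝ _)

end Divergence

/-! ### Passing between the manifold and its charts. -/

section ChartTransport

open VectorField

variable {E : Type*} [NormedAddCommGroup E] [NormedSpace ℝ E]
  {M : Type*} [TopologicalSpace M] [ChartedSpace E M]

/-- The differential of the chart at `c`. -/
def coframe (c x : M) : TangentSpace 𝓘(ℝ, E) x →L[ℝ] E :=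
  mfderiv 𝓘(ℝ, E) 𝓘(ℝ, E) (extChartAt 𝓘(ℝ, E) c) x

/-- The inverse of the differential of the chart at `c`: the vector `frame c x v` is the value at
`x` of the coordinate field in the direction `v`. -/
def frame (c x : M) : E →L[ℝ] TangentSpace 𝓘(ℝ, E) x := (coframe c x).inverse

variable [IsManifold 𝓘(ℝ, E) ∞ M]

lemma isManifold_of_le_infty (k : ℕ∞) : IsManifold 𝓘(ℝ, E) k M :=
  IsManifold.of_le (n := ∞) (by exact_mod_cast le_top)

lemma isInvertible_coframe {c x : M} (hx : x ∈ (extChartAt 𝓘(ℝ, E) c).source) :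
    (coframe (E := E) c x).IsInvertible := isInvertible_mfderiv_extChartAt hx

lemma frame_coframe {c x : M} (hx : x ∈ (extChartAt 𝓘(ℝ, E) c).source)
    (v : TangentSpace 𝓘(ℝ, E) x) : frame c x (coframe c x v) = v :=
  ((isInvertible_coframe hx).inverse_apply_eq).mpr rfl

lemma coframe_frame {c x : M} (hx : x ∈ (extChartAt 𝓘(ℝ, E) c).source) (v : E) :
    coframe c x (frame c x v) = v :=
  (((isInvertible_coframe hx).inverse_apply_eq).mp rfl).symm

lemma frame_symm_apply {c : M} {p : E} (hp : p ∈ (extChartAt 𝓘(ℝ, E) c).target) (v : E) :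
    frame c ((extChartAt 𝓘(ℝ, E) c).symm p) v =
      mfderiv 𝓘(ℝ, E) 𝓘(ℝ, E) (extChartAt 𝓘(ℝ, E) c).symm p v := by
  rw [← mfderivWithin_univ]
  have h1 := mfderiv_extChartAt_comp_mfderivWithin_extChartAt_symm (I := 𝓘(ℝ, E)) hp
  have h2 := mfderivWithin_extChartAt_symm_comp_mfderiv_extChartAt (I := 𝓘(ℝ, E)) hp
  simp only [modelWithCornersSelf_coe, Set.range_id] at h1 h2
  exact congrArg (fun L ↦ L v) (ContinuousLinearMap.inverse_eq h1 h2)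

lemma mdifferentiableAt_extChartAt_symm {c : M} {p : E}
    (hp : p ∈ (extChartAt 𝓘(ℝ, E) c).target) :
    MDifferentiableAt 𝓘(ℝ, E) 𝓘(ℝ, E) (extChartAt 𝓘(ℝ, E) c).symm p := by
  have := mdifferentiableWithinAt_extChartAt_symm (I := 𝓘(ℝ, E)) hp
  rwa [modelWithCornersSelf_coe, Set.range_id, mdifferentiableWithinAt_univ] at this

variable {F : Type*} [NormedAddCommGroup F] [NormedSpace ℝ F]

lemma differentiableAt_comp_extChartAt_symm {c : M} {p : E}
    (hp : p ∈ (extChartAt 𝓘(ℝ, E) c).target) {f : M → F}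
    (hf : MDifferentiableAt 𝓘(ℝ, E) 𝓘(ℝ, F) f ((extChartAt 𝓘(ℝ, E) c).symm p)) :
    DifferentiableAt ℝ (f ∘ (extChartAt 𝓘(ℝ, E) c).symm) p :=
  (hf.comp p (mdifferentiableAt_extChartAt_symm hp)).differentiableAt

lemma fderiv_comp_extChartAt_symm {c : M} {p : E}
    (hp : p ∈ (extChartAt 𝓘(ℝ, E) c).target) {f : M → F}
    (hf : MDifferentiableAt 𝓘(ℝ, E) 𝓘(ℝ, F) f ((extChartAt 𝓘(ℝ, E) c).symm p)) (v : E) :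
    fderiv ℝ (f ∘ (extChartAt 𝓘(ℝ, E) c).symm) p v =
      mvfderiv 𝓘(ℝ, E) f ((extChartAt 𝓘(ℝ, E) c).symm p)
        (frame c ((extChartAt 𝓘(ℝ, E) c).symm p) v) := by
  rw [frame_symm_apply hp, ← mfderiv_eq_fderiv,
    mfderiv_comp p hf (mdifferentiableAt_extChartAt_symm hp)]
  rfl

lemma contDiffOn_comp_extChartAt_symm {c : M} {U : Set M} {f : M → F}
    (hf : ContMDiffOn 𝓘(ℝ, E) 𝓘(ℝ, F) ∞ f U) :
    ContDiffOn ℝ ∞ (f ∘ (extChartAt 𝓘(ℝ, E) c).symm)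
      ((extChartAt 𝓘(ℝ, E) c).target ∩ (extChartAt 𝓘(ℝ, E) c).symm ⁻¹' U) := by
  rw [← contMDiffOn_iff_contDiffOn]
  exact hf.comp ((contMDiffOn_extChartAt_symm c).mono Set.inter_subset_left) fun p hp ↦ hp.2

/-- Smoothness of sections is defined through bundle trivializations; this identification lets it be
tested on coordinates in a chart. -/
lemma coframe_eq_trivialization {c x : M} (hx : x ∈ (extChartAt 𝓘(ℝ, E) c).source)
    (v : TangentSpace 𝓘(ℝ, E) x) :
    coframe c x v = (trivializationAt E (TangentSpace 𝓘(ℝ, E)) c ⟨x, v⟩).2 := by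
  rw [extChartAt_source] at hx
  rw [coframe, ← TangentBundle.continuousLinearMapAt_trivializationAt hx,
    Trivialization.continuousLinearMapAt_apply, Trivialization.linearMapAt_apply, if_pos]
  exact hx

lemma mdifferentiableAt_coframe {c x : M} (hx : x ∈ (extChartAt 𝓘(ℝ, E) c).source)
    {Y : Π x : M, TangentSpace 𝓘(ℝ, E) x}
    (hY : MDifferentiableAt 𝓘(ℝ, E) 𝓘(ℝ, E).tangent
      (fun x ↦ (⟨x, Y x⟩ : TangentBundle 𝓘(ℝ, E) M)) x) :
    MDifferentiableAt 𝓘(ℝ, E) 𝓘(ℝ, E) (fun y ↦ coframe c y (Y y)) x := by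
  have hs : x ∈ (trivializationAt E (TangentSpace 𝓘(ℝ, E)) c).baseSet := by
    simpa using hx
  have h := ((trivializationAt E (TangentSpace 𝓘(ℝ, E)) c).mdifferentiableAt_section_iff
    𝓘(ℝ, E) Y hs).mp hY
  refine h.congr_of_eventuallyEq ?_
  filter_upwards [(isOpen_extChartAt_source c).mem_nhds hx] with y hy
  exact coframe_eq_trivialization hy _

lemma contMDiffOn_coframe {c : M} {U : Set M} (hU : IsOpen U)
    (hUc : U ⊆ (extChartAt 𝓘(ℝ, E) c).source)
    {Y : Π x : M, TangentSpace 𝓘(ℝ, E) x}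
    (hY : ContMDiffOn 𝓘(ℝ, E) 𝓘(ℝ, E).tangent ∞
      (fun x ↦ (⟨x, Y x⟩ : TangentBundle 𝓘(ℝ, E) M)) U) :
    ContMDiffOn 𝓘(ℝ, E) 𝓘(ℝ, E) ∞ (fun y ↦ coframe c y (Y y)) U := by
  have hs : U ⊆ (trivializationAt E (TangentSpace 𝓘(ℝ, E)) c).baseSet := by
    simpa using hUc
  have h := ((trivializationAt E (TangentSpace 𝓘(ℝ, E)) c).contMDiffOn_section_iff
    (IB := 𝓘(ℝ, E)) hU hs).mp hY
  exact h.congr fun y hy ↦ coframe_eq_trivialization (hUc hy) _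

/-- A vector field is smooth if its coordinates are. -/
lemma contMDiffOn_frame_apply {c : M} {U : Set M} (hU : IsOpen U)
    (hUc : U ⊆ (extChartAt 𝓘(ℝ, E) c).source) {y : M → E}
    (hy : ContMDiffOn 𝓘(ℝ, E) 𝓘(ℝ, E) ∞ y U) :
    ContMDiffOn 𝓘(ℝ, E) 𝓘(ℝ, E).tangent ∞
      (fun x ↦ (⟨x, frame c x (y x)⟩ : TangentBundle 𝓘(ℝ, E) M)) U := by
  have hs : U ⊆ (trivializationAt E (TangentSpace 𝓘(ℝ, E)) c).baseSet := by
    simpa using hUc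
  refine ((trivializationAt E (TangentSpace 𝓘(ℝ, E)) c).contMDiffOn_section_iff
    (IB := 𝓘(ℝ, E)) hU hs).mpr (hy.congr fun x hx ↦ ?_)
  rw [← coframe_eq_trivialization (hUc hx), coframe_frame (hUc hx)]

lemma contMDiffOn_frame (c : M) (v : E) :
    ContMDiffOn 𝓘(ℝ, E) 𝓘(ℝ, E).tangent ∞
      (fun x ↦ (⟨x, frame c x v⟩ : TangentBundle 𝓘(ℝ, E) M)) (extChartAt 𝓘(ℝ, E) c).source :=
  contMDiffOn_frame_apply (isOpen_extChartAt_source c) subset_rfl contMDiffOn_const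

lemma mdifferentiableAt_of_contMDiffOn {U : Set M} (hU : IsOpen U) {x : M} (hx : x ∈ U)
    {Y : Π x : M, TangentSpace 𝓘(ℝ, E) x}
    (hY : ContMDiffOn 𝓘(ℝ, E) 𝓘(ℝ, E).tangent ∞
      (fun x ↦ (⟨x, Y x⟩ : TangentBundle 𝓘(ℝ, E) M)) U) :
    MDifferentiableAt 𝓘(ℝ, E) 𝓘(ℝ, E).tangent
      (fun x ↦ (⟨x, Y x⟩ : TangentBundle 𝓘(ℝ, E) M)) x :=
  (hY.contMDiffAt (hU.mem_nhds hx)).mdifferentiableAt (by simp)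

lemma mdifferentiableAt_frame {c x : M} (hx : x ∈ (extChartAt 𝓘(ℝ, E) c).source) (v : E) :
    MDifferentiableAt 𝓘(ℝ, E) 𝓘(ℝ, E).tangent
      (fun x ↦ (⟨x, frame c x v⟩ : TangentBundle 𝓘(ℝ, E) M)) x :=
  mdifferentiableAt_of_contMDiffOn (isOpen_extChartAt_source c) hx (contMDiffOn_frame c v)

/-- Coordinate fields commute. -/
lemma mlieBracket_frame [CompleteSpace E] {c x : M} (hx : x ∈ (extChartAt 𝓘(ℝ, E) c).source)
    (v w : E) :
    mlieBracket 𝓘(ℝ, E) (fun y ↦ frame c y v) (fun y ↦ frame c y w) x = 0 := by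
  have : IsManifold 𝓘(ℝ, E) (minSmoothness ℝ 3) M := by
    rw [minSmoothness_of_isRCLikeNormedField]; exact isManifold_of_le_infty 3
  let V : Π x : E, TangentSpace 𝓘(ℝ, E) x := fun _ ↦ v
  let W : Π x : E, TangentSpace 𝓘(ℝ, E) x := fun _ ↦ w
  have h0 : mlieBracket 𝓘(ℝ, E) V W = 0 := by
    rw [← mlieBracketWithin_univ, mlieBracketWithin_eq_lieBracketWithin]
    ext p
    simp [lieBracketWithin, V, W]
    rfl
  -- Coordinate fields are pull-backs of constant fields by the chart, and pull-back respects the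
  -- bracket.
  have h := mpullback_mlieBracket (I := 𝓘(ℝ, E)) (I' := 𝓘(ℝ, E)) (n := 2)
    (f := extChartAt 𝓘(ℝ, E) c) (x₀ := x)
    (V := V) (W := W) ?_ ?_ ?_ ?_
  · refine Eq.trans h.symm ?_
    rw [mpullback_apply, h0]
    exact map_zero _
  · exact (contMDiffAt_vectorSpace_iff_contDiffAt (n := 1)).mpr contDiffAt_const
      |>.mdifferentiableAt one_ne_zero
  · exact (contMDiffAt_vectorSpace_iff_contDiffAt (n := 1)).mpr contDiffAt_const
      |>.mdifferentiableAt one_ne_zero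
  · rw [extChartAt_source] at hx
    exact contMDiffAt_extChartAt' hx
  · simp

end ChartTransport

/-! ### Christoffel symbols of a connection. -/

section Christoffel

variable {E : Type*} [NormedAddCommGroup E] [NormedSpace ℝ E] [FiniteDimensional ℝ E]
  {M : Type*} [TopologicalSpace M] [ChartedSpace E M] [IsManifold 𝓘(ℝ, E) ∞ M]
  (nabla : CovariantDerivative 𝓘(ℝ, E) E (TangentSpace 𝓘(ℝ, E) : M → Type _))

/-- A covariant derivative in the coordinates of a chart. -/
lemma coframe_cov_apply {c x : M} (hx : x ∈ (extChartAt 𝓘(ℝ, E) c).source)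
    {Y : Π x : M, TangentSpace 𝓘(ℝ, E) x}
    (hY : MDifferentiableAt 𝓘(ℝ, E) 𝓘(ℝ, E).tangent
      (fun x ↦ (⟨x, Y x⟩ : TangentBundle 𝓘(ℝ, E) M)) x) (v : TangentSpace 𝓘(ℝ, E) x) :
    coframe c x (nabla Y x v) = mvfderiv 𝓘(ℝ, E) (fun y ↦ coframe c y (Y y)) x v +
      coframe c x (nabla (fun y ↦ frame c y (coframe c x (Y x))) x v) := by
  -- Subtracting the chart derivative cancels the Leibniz term, so `Φ` is tensorial and depends only
  -- on `Y x`. It may be evaluated on the coordinate field with that value, whose coordinates are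
  -- constant.
  let Φ : (Π x : M, TangentSpace 𝓘(ℝ, E) x) → E := fun Y ↦
    coframe c x (nabla Y x v) - mvfderiv 𝓘(ℝ, E) (fun y ↦ coframe c y (Y y)) x v
  have hΦ : TensorialAt 𝓘(ℝ, E) E Φ x := by
    constructor
    · intro f σ hf hσ
      have h1 := nabla.isCovariantDerivativeOnUniv.leibniz hσ hf
      have h2 := mvfderiv_smul hf (mdifferentiableAt_coframe hx hσ)
      have h3 : (fun y ↦ coframe c y ((f • σ) y)) = f • fun y ↦ coframe c y (σ y) := by
        ext y; simp
      simp only [Φ]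
      rw [h1, h3, h2]
      simp [smul_sub]
    · intro σ σ' hσ hσ'
      have h1 := nabla.isCovariantDerivativeOnUniv.add hσ hσ'
      have h2 := mvfderiv_add (mdifferentiableAt_coframe hx hσ) (mdifferentiableAt_coframe hx hσ')
      have h3 : (fun y ↦ coframe c y ((σ + σ') y)) =
          (fun y ↦ coframe c y (σ y)) + fun y ↦ coframe c y (σ' y) := by
        ext y; simp
      simp only [Φ]
      rw [h1, h3, h2]
      simp
      abel
  have h := hΦ.pointwise hY (mdifferentiableAt_frame hx (coframe c x (Y x)))
    (frame_coframe hx (Y x)).symm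
  have hconst : mvfderiv 𝓘(ℝ, E) (fun y ↦ coframe c y (frame c y (coframe c x (Y x)))) x v = 0 := by
    have : (fun y ↦ coframe c y (frame c y (coframe c x (Y x)))) =ᶠ[𝓝 x]
        fun _ ↦ coframe c x (Y x) := by
      filter_upwards [(isOpen_extChartAt_source c).mem_nhds hx] with y hy
      exact coframe_frame hy _
    rw [mvfderiv, this.mfderiv_eq, mfderiv_const]
    rfl
  simp only [Φ] at h
  rw [hconst, sub_zero] at h
  rw [← h]
  abel

/-- The Christoffel symbols of a connection in the chart at `c`. -/
def christoffel (c : M) (p : E) : E →L[ℝ] E →L[ℝ] E :=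
  ∑ i, (LinearMap.toContinuousLinearMap ((Module.finBasis ℝ E).coord i)).smulRight
    (coframe c ((extChartAt 𝓘(ℝ, E) c).symm p) ∘L
      nabla (fun y ↦ frame c y (Module.finBasis ℝ E i)) ((extChartAt 𝓘(ℝ, E) c).symm p) ∘L
      frame c ((extChartAt 𝓘(ℝ, E) c).symm p))

/-- Additivity of a connection needs differentiable sections, so this expression is seen to be
linear in `w` only over the chart domain. Expanding in a basis in the definition makes linearity
automatic everywhere. -/
lemma christoffel_apply {c : M} {p : E} (hp : p ∈ (extChartAt 𝓘(ℝ, E) c).target) (w v : E) :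
    christoffel nabla c p w v = coframe c ((extChartAt 𝓘(ℝ, E) c).symm p)
      (nabla (fun y ↦ frame c y w) ((extChartAt 𝓘(ℝ, E) c).symm p)
        (frame c ((extChartAt 𝓘(ℝ, E) c).symm p) v)) := by
  set x := (extChartAt 𝓘(ℝ, E) c).symm p
  have hx : x ∈ (extChartAt 𝓘(ℝ, E) c).source := (extChartAt 𝓘(ℝ, E) c).map_target hp
  let L : E →ₗ[ℝ] E :=
    { toFun := fun w ↦ coframe c x (nabla (fun y ↦ frame c y w) x (frame c x v))
      map_add' := fun w w' ↦ by
        have h := nabla.isCovariantDerivativeOnUniv.add (mdifferentiableAt_frame hx w)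
          (mdifferentiableAt_frame hx w')
        have h' : (fun y ↦ frame (E := E) c y (w + w')) =
          (fun y ↦ frame (E := E) c y w) + fun y ↦ frame (E := E) c y w' := by ext y; simp
        rw [h', h]
        simp
      map_smul' := fun r w ↦ by
        have h := nabla.isCovariantDerivativeOnUniv.smul_const r (mdifferentiableAt_frame hx w)
        have h' : (fun y ↦ frame (E := E) c y (r • w)) = r • fun y ↦ frame (E := E) c y w := by
          ext y; simp
        rw [h', h]
        simp }
  change _ = L w
  conv_rhs => rw [← (Module.finBasis ℝ E).sum_repr w, map_sum]
  simp [christoffel, L, x]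
  rfl

/-- Near a point of `U`, the local field agrees with its product by a bump function, which is
globally smooth; smoothness of the connection applies to the product, and connections are local. -/
lemma contMDiffOn_cov {U : Set M} (hU : IsOpen U)
    (hnabla : nabla.ContMDiffCovariantDerivative ∞) [T2Space M]
    {Y : Π x : M, TangentSpace 𝓘(ℝ, E) x}
    (hY : ContMDiffOn 𝓘(ℝ, E) 𝓘(ℝ, E).tangent ∞
      (fun x ↦ (⟨x, Y x⟩ : TangentBundle 𝓘(ℝ, E) M)) U) :
    ContMDiffOn 𝓘(ℝ, E) (𝓘(ℝ, E).prod 𝓘(ℝ, E →L[ℝ] E)) ∞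
    (fun x ↦ TotalSpace.mk' (E →L[ℝ] E)
      (E := fun x : M ↦ TangentSpace 𝓘(ℝ, E) x →L[ℝ] TangentSpace 𝓘(ℝ, E) x) x (nabla Y x)) U := by
  intro x hx
  obtain ⟨f, hf⟩ : ∃ f : SmoothBumpFunction 𝓘(ℝ, E) x, tsupport f ⊆ U :=
    ((SmoothBumpFunction.nhds_basis_tsupport (I := 𝓘(ℝ, E)) x).mem_iff.mp
      (hU.mem_nhds hx)).imp fun f hf ↦ hf.2
  have hfY : ContMDiff 𝓘(ℝ, E) 𝓘(ℝ, E).tangent ∞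
      (fun x ↦ (⟨x, ((f : M → ℝ) • Y) x⟩ : TangentBundle 𝓘(ℝ, E) M)) :=
    ContMDiffOn.smul_section_of_tsupport f.contMDiff.contMDiffOn hU hf hY
  have h := (hnabla.contMDiff.contMDiff (σ := (f : M → ℝ) • Y) (by
    simpa using hfY.contMDiffOn)).contMDiffAt Filter.univ_mem (x := x)
  refine (h.congr_of_eventuallyEq ?_).contMDiffWithinAt
  have h1 := f.eventuallyEq_one
  filter_upwards [h1.eventually_nhds, hU.mem_nhds hx] with y hy hyU
  have : nabla Y y = nabla ((f : M → ℝ) • Y) y := by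
    refine nabla.isCovariantDerivativeOnUniv.congr_of_eventuallyEq
      (mdifferentiableAt_of_contMDiffOn hU hyU hY)
      (hfY.contMDiffAt.mdifferentiableAt (by simp)) Filter.univ_mem ?_
    filter_upwards [hy] with z hz
    simp [hz]
  rw [this]

lemma contDiffOn_christoffel (hnabla : nabla.ContMDiffCovariantDerivative ∞) [T2Space M] (c : M) :
    ContDiffOn ℝ ∞ (christoffel nabla c) (extChartAt 𝓘(ℝ, E) c).target := by
  rw [contDiffOn_clm_apply]
  intro w
  rw [contDiffOn_clm_apply]
  intro v
  have h1 := (contMDiffOn_cov nabla (isOpen_extChartAt_source c) hnabla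
    (contMDiffOn_frame c w)).clm_bundle_apply (contMDiffOn_frame c v)
  have h2 := contDiffOn_comp_extChartAt_symm (c := c)
    (contMDiffOn_coframe (isOpen_extChartAt_source c) subset_rfl h1)
  refine (h2.mono fun p hp ↦ ⟨hp, (extChartAt 𝓘(ℝ, E) c).map_target hp⟩).congr fun p hp ↦ ?_
  rw [christoffel_apply nabla hp]
  rfl

/-- The dictionary that carries the coordinate identities back to the manifold. -/
lemma covDeriv_christoffel {c : M} {p : E} (hp : p ∈ (extChartAt 𝓘(ℝ, E) c).target)
    {Y : Π x : M, TangentSpace 𝓘(ℝ, E) x}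
    (hY : MDifferentiableAt 𝓘(ℝ, E) 𝓘(ℝ, E).tangent
      (fun x ↦ (⟨x, Y x⟩ : TangentBundle 𝓘(ℝ, E) M)) ((extChartAt 𝓘(ℝ, E) c).symm p)) (v : E) :
    covDeriv (christoffel nabla c)
      ((fun y ↦ coframe c y (Y y)) ∘ (extChartAt 𝓘(ℝ, E) c).symm) p v =
    coframe c ((extChartAt 𝓘(ℝ, E) c).symm p) (nabla Y ((extChartAt 𝓘(ℝ, E) c).symm p)
      (frame c ((extChartAt 𝓘(ℝ, E) c).symm p) v)) := by
  have hx := (extChartAt 𝓘(ℝ, E) c).map_target hp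
  rw [coframe_cov_apply nabla hx hY, covDeriv, add_apply, christoffel_apply nabla hp,
    fderiv_comp_extChartAt_symm hp (mdifferentiableAt_coframe hx hY)]
  rfl

end Christoffel

/-! ### The Kähler structure read in a chart. -/

section KaehlerTransport

variable {E : Type*} [NormedAddCommGroup E] [NormedSpace ℝ E]
  {M : Type*} [TopologicalSpace M] [ChartedSpace E M]

lemma fderiv_clm_apply_const {F G : Type*} [NormedAddCommGroup F] [NormedSpace ℝ F]
    [NormedAddCommGroup G] [NormedSpace ℝ G] {A : E → F →L[ℝ] G} {p : E}
    (hA : DifferentiableAt ℝ A p) (v : E) (w : F) :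
    fderiv ℝ A p v w = fderiv ℝ (fun q ↦ A q w) p v := by
  rw [(hA.hasFDerivAt.clm_apply (hasFDerivAt_const w p)).fderiv]
  simp

section Metric

section

variable [RiemannianBundle (fun x : M ↦ TangentSpace 𝓘(ℝ, E) x)]

/-- The metric on a tangent space, as a bilinear form. -/
def tangentMetric (x : M) :
    TangentSpace 𝓘(ℝ, E) x →L[ℝ] TangentSpace 𝓘(ℝ, E) x →L[ℝ] ℝ :=
  (RiemannianBundle.g (E := fun x : M ↦ TangentSpace 𝓘(ℝ, E) x)).inner x

lemma inner_eq_tangentMetric {x : M} (v w : TangentSpace 𝓘(ℝ, E) x) :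
    inner ℝ v w = tangentMetric x v w := rfl

lemma tangentMetric_symm {x : M} (v w : TangentSpace 𝓘(ℝ, E) x) :
    tangentMetric x v w = tangentMetric x w v :=
  (RiemannianBundle.g (E := fun x : M ↦ TangentSpace 𝓘(ℝ, E) x)).symm x v w

lemma tangentMetric_pos {x : M} {v : TangentSpace 𝓘(ℝ, E) x} (hv : v ≠ 0) :
    0 < tangentMetric x v v :=
  (RiemannianBundle.g (E := fun x : M ↦ TangentSpace 𝓘(ℝ, E) x)).pos x v hv

lemma eq_of_tangentMetric_eq {x : M} {v w : TangentSpace 𝓘(ℝ, E) x}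
    (h : ∀ z, tangentMetric x v z = tangentMetric x w z) : v = w := by
  by_contra hne
  refine (tangentMetric_pos (sub_ne_zero.mpr hne)).ne' ?_
  have h1 : tangentMetric x (v - w) = tangentMetric x v - tangentMetric x w :=
    (tangentMetric x).map_sub v w
  rw [h1]
  exact sub_eq_zero.mpr (h (v - w))

/-- The metric in the chart at `c`. -/
def chartMetric (c : M) (p : E) : E →L[ℝ] E →L[ℝ] ℝ :=
  let g : E →L[ℝ] E →L[ℝ] ℝ := tangentMetric ((extChartAt 𝓘(ℝ, E) c).symm p)
  let A : E →L[ℝ] E := frame c ((extChartAt 𝓘(ℝ, E) c).symm p)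
  g.bilinearComp A A

lemma chartMetric_apply (c : M) (p v w : E) :
    chartMetric c p v w = tangentMetric ((extChartAt 𝓘(ℝ, E) c).symm p)
      (frame c ((extChartAt 𝓘(ℝ, E) c).symm p) v)
      (frame c ((extChartAt 𝓘(ℝ, E) c).symm p) w) := rfl

lemma chartMetric_symm (c : M) (p v w : E) : chartMetric c p v w = chartMetric c p w v := by
  rw [chartMetric_apply, chartMetric_apply, tangentMetric_symm]

variable [IsManifold 𝓘(ℝ, E) ∞ M]

lemma chartMetric_pos {c : M} {p : E} (hp : p ∈ (extChartAt 𝓘(ℝ, E) c).target) {v : E}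
    (hv : v ≠ 0) : 0 < chartMetric c p v v := by
  rw [chartMetric_apply]
  refine tangentMetric_pos fun h ↦ hv ?_
  rw [← coframe_frame ((extChartAt 𝓘(ℝ, E) c).map_target hp) v, h, map_zero]

end

variable [IsManifold 𝓘(ℝ, E) ∞ M] [RiemannianBundle (fun x : M ↦ TangentSpace 𝓘(ℝ, E) x)]
  [IsContMDiffRiemannianBundle 𝓘(ℝ, E) ∞ E (fun x : M ↦ TangentSpace 𝓘(ℝ, E) x)]

lemma contMDiffOn_tangentMetric {U : Set M} {X Y : Π x : M, TangentSpace 𝓘(ℝ, E) x}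
    (hX : ContMDiffOn 𝓘(ℝ, E) 𝓘(ℝ, E).tangent ∞
      (fun x ↦ (⟨x, X x⟩ : TangentBundle 𝓘(ℝ, E) M)) U)
    (hY : ContMDiffOn 𝓘(ℝ, E) 𝓘(ℝ, E).tangent ∞
      (fun x ↦ (⟨x, Y x⟩ : TangentBundle 𝓘(ℝ, E) M)) U) :
    ContMDiffOn 𝓘(ℝ, E) 𝓘(ℝ, ℝ) ∞ (fun x ↦ tangentMetric x (X x) (Y x)) U := 
  ContMDiffOn.inner_bundle (E := (TangentSpace 𝓘(ℝ, E) : M → Type _)) (b := id) hX hY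

lemma mdifferentiableAt_tangentMetric {x : M} {X Y : Π x : M, TangentSpace 𝓘(ℝ, E) x}
    (hX : MDifferentiableAt 𝓘(ℝ, E) 𝓘(ℝ, E).tangent
      (fun x ↦ (⟨x, X x⟩ : TangentBundle 𝓘(ℝ, E) M)) x)
    (hY : MDifferentiableAt 𝓘(ℝ, E) 𝓘(ℝ, E).tangent
      (fun x ↦ (⟨x, Y x⟩ : TangentBundle 𝓘(ℝ, E) M)) x) :
    MDifferentiableAt 𝓘(ℝ, E) 𝓘(ℝ, ℝ) (fun x ↦ tangentMetric x (X x) (Y x)) x :=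
  MDifferentiableAt.inner_bundle (E := (TangentSpace 𝓘(ℝ, E) : M → Type _)) (b := id) hX hY

variable [FiniteDimensional ℝ E]

lemma contDiffOn_chartMetric (c : M) :
    ContDiffOn ℝ ∞ (chartMetric c) (extChartAt 𝓘(ℝ, E) c).target := by
  rw [contDiffOn_clm_apply]
  intro v
  rw [contDiffOn_clm_apply]
  intro w
  have h1 := contMDiffOn_tangentMetric (contMDiffOn_frame c v) (contMDiffOn_frame c w)
  have h2 := contDiffOn_comp_extChartAt_symm (c := c) h1
  exact h2.mono fun p hp ↦ ⟨hp, (extChartAt 𝓘(ℝ, E) c).map_target hp⟩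

lemma derivMetricTensor_tangent
    (D : CovariantDerivative 𝓘(ℝ, E) E (TangentSpace 𝓘(ℝ, E) : M → Type _))
    {x : M} {X Y : Π x : M, TangentSpace 𝓘(ℝ, E) x}
    (hX : MDifferentiableAt 𝓘(ℝ, E) 𝓘(ℝ, E).tangent
      (fun x ↦ (⟨x, X x⟩ : TangentBundle 𝓘(ℝ, E) M)) x)
    (hY : MDifferentiableAt 𝓘(ℝ, E) 𝓘(ℝ, E).tangent
      (fun x ↦ (⟨x, Y x⟩ : TangentBundle 𝓘(ℝ, E) M)) x) (v : TangentSpace 𝓘(ℝ, E) x) :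
    D.derivMetricTensor (V := (TangentSpace 𝓘(ℝ, E) : M → Type _)) x (X x) (Y x) v =
      mvfderiv 𝓘(ℝ, E) (fun x ↦ tangentMetric x (X x) (Y x)) x v -
      tangentMetric x (D X x v) (Y x) - tangentMetric x (X x) (D Y x v) := by
  have h := CovariantDerivative.derivMetricTensor_apply
    (V := (TangentSpace 𝓘(ℝ, E) : M → Type _)) D x
    (X := fun y ↦ FiberBundle.extend E v y) hX hY
  simp only [FiberBundle.extend_apply_self] at h
  exact h

/-- Coordinate fields commute, so vanishing torsion on them is symmetry of the symbols. -/
lemma IsLeviCivita.christoffel_symm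
    {nabla : CovariantDerivative 𝓘(ℝ, E) E (TangentSpace 𝓘(ℝ, E) : M → Type _)}
    (hnabla : IsLeviCivita nabla) {c : M} {q : E} (hq : q ∈ (extChartAt 𝓘(ℝ, E) c).target)
    (v w : E) : christoffel nabla c q v w = christoffel nabla c q w v := by
  have hx := (extChartAt 𝓘(ℝ, E) c).map_target hq
  have h := nabla.torsion_eq_zero_iff.mp hnabla.torsion_eq_zero
    (mdifferentiableAt_frame hx v) (mdifferentiableAt_frame hx w)
  rw [mlieBracket_frame hx, sub_eq_zero] at h
  rw [christoffel_apply nabla hq, christoffel_apply nabla hq, h]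

lemma IsLeviCivita.mvfderiv_tangentMetric
    {nabla : CovariantDerivative 𝓘(ℝ, E) E (TangentSpace 𝓘(ℝ, E) : M → Type _)}
    (hnabla : IsLeviCivita nabla) {x : M}
    {X Y : Π x : M, TangentSpace 𝓘(ℝ, E) x}
    (hX : MDifferentiableAt 𝓘(ℝ, E) 𝓘(ℝ, E).tangent
      (fun x ↦ (⟨x, X x⟩ : TangentBundle 𝓘(ℝ, E) M)) x)
    (hY : MDifferentiableAt 𝓘(ℝ, E) 𝓘(ℝ, E).tangent
      (fun x ↦ (⟨x, Y x⟩ : TangentBundle 𝓘(ℝ, E) M)) x) (v : TangentSpace 𝓘(ℝ, E) x) :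
    mvfderiv 𝓘(ℝ, E) (fun x ↦ tangentMetric x (X x) (Y x)) x v =
      tangentMetric x (nabla X x v) (Y x) + tangentMetric x (X x) (nabla Y x v) := by
  have h := derivMetricTensor_tangent nabla hX hY v
  rw [hnabla.metric, sub_sub] at h
  exact sub_eq_zero.mp h.symm

lemma differentiableAt_chartMetric {c : M} {q : E} (hq : q ∈ (extChartAt 𝓘(ℝ, E) c).target) :
    DifferentiableAt ℝ (chartMetric (E := E) c) q :=
  ((contDiffOn_chartMetric c).contDiffAt
    ((isOpen_extChartAt_target c).mem_nhds hq)).differentiableAt (by simp)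

lemma IsLeviCivita.fderiv_chartMetric
    {nabla : CovariantDerivative 𝓘(ℝ, E) E (TangentSpace 𝓘(ℝ, E) : M → Type _)}
    (hnabla : IsLeviCivita nabla) {c : M} {q : E} (hq : q ∈ (extChartAt 𝓘(ℝ, E) c).target)
    (v a b : E) :
    fderiv ℝ (chartMetric c) q v a b = chartMetric c q (christoffel nabla c q a v) b +
      chartMetric c q a (christoffel nabla c q b v) := by
  have hx := (extChartAt 𝓘(ℝ, E) c).map_target hq
  have hd := differentiableAt_chartMetric hq
  have hda : DifferentiableAt ℝ (fun q ↦ chartMetric (E := E) c q a) q :=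
    hd.clm_apply (differentiableAt_const a)
  have ha := mdifferentiableAt_frame hx a
  have hb := mdifferentiableAt_frame hx b
  have h2 := fderiv_comp_extChartAt_symm hq (mdifferentiableAt_tangentMetric ha hb) v
  rw [fderiv_clm_apply_const hd, fderiv_clm_apply_const hda]
  refine h2.trans ?_
  rw [chartMetric_apply, chartMetric_apply, christoffel_apply nabla hq,
    christoffel_apply nabla hq, frame_coframe hx, frame_coframe hx]
  exact hnabla.mvfderiv_tangentMetric ha hb _

end Metric

variable [FiniteDimensional ℝ E] [IsManifold 𝓘(ℝ, E) ∞ M]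

/-- An endomorphism field in the chart at `c`. -/
def chartEndomorphism (J : Π x : M, TangentSpace 𝓘(ℝ, E) x →L[ℝ] TangentSpace 𝓘(ℝ, E) x)
    (c : M) (p : E) : E →L[ℝ] E :=
  coframe c ((extChartAt 𝓘(ℝ, E) c).symm p) ∘L J ((extChartAt 𝓘(ℝ, E) c).symm p) ∘L
    frame c ((extChartAt 𝓘(ℝ, E) c).symm p)

lemma contDiffOn_chartEndomorphism
    {J : Π x : M, TangentSpace 𝓘(ℝ, E) x →L[ℝ] TangentSpace 𝓘(ℝ, E) x}
    (hJ : IsSmoothEndomorphism J) (c : M) :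
    ContDiffOn ℝ ∞ (chartEndomorphism J c) (extChartAt 𝓘(ℝ, E) c).target := by
  rw [contDiffOn_clm_apply]
  intro v
  have h1 := hJ.contMDiffOn.clm_bundle_apply (contMDiffOn_frame c v)
  have h2 := contDiffOn_comp_extChartAt_symm (c := c)
    (contMDiffOn_coframe (isOpen_extChartAt_source c) subset_rfl h1)
  exact h2.mono fun p hp ↦ ⟨hp, (extChartAt 𝓘(ℝ, E) c).map_target hp⟩

variable [T2Space M] [RiemannianBundle (fun x : M ↦ TangentSpace 𝓘(ℝ, E) x)]
  [IsContMDiffRiemannianBundle 𝓘(ℝ, E) ∞ E (fun x : M ↦ TangentSpace 𝓘(ℝ, E) x)]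

/-- A Kähler structure in the coordinates of a chart. -/
lemma IsKaehler.isKaehlerChart
    {J : Π x : M, TangentSpace 𝓘(ℝ, E) x →L[ℝ] TangentSpace 𝓘(ℝ, E) x} (hJ : IsKaehler J)
    {nabla : CovariantDerivative 𝓘(ℝ, E) E (TangentSpace 𝓘(ℝ, E) : M → Type _)}
    (hnabla : IsLeviCivita nabla) (hpar : IsParallelEndomorphism nabla J) (c : M) :
    IsKaehlerChart (extChartAt 𝓘(ℝ, E) c).target (chartMetric c) (christoffel nabla c)
      (chartEndomorphism J c) where
  isOpen := isOpen_extChartAt_target c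
  contDiffOn_metric := contDiffOn_chartMetric c
  contDiffOn_christoffel := contDiffOn_christoffel nabla hnabla.smooth c
  contDiffOn_complex := contDiffOn_chartEndomorphism hJ.smooth c
  metric_symm q _ v w := chartMetric_symm c q v w
  metric_pos q hq v hv := chartMetric_pos hq hv
  christoffel_symm q hq v w := hnabla.christoffel_symm hq v w
  metric_parallel q hq v a b := hnabla.fderiv_chartMetric hq v a b
  complex_parallel q hq v w := by
    have hx := (extChartAt 𝓘(ℝ, E) c).map_target hq
    have hd : DifferentiableAt ℝ (chartEndomorphism J c) q :=
      ((contDiffOn_chartEndomorphism hJ.smooth c).contDiffAt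
        ((isOpen_extChartAt_target c).mem_nhds hq)).differentiableAt (by simp)
    have hs := hJ.smooth.contMDiffOn.clm_bundle_apply (contMDiffOn_frame c w)
    -- The field is `J` applied to a coordinate field. Its chart expression is `J` at a constant
    -- vector, so the covariant derivative is the derivative of `J` plus a Christoffel term.
    have h1 := covDeriv_christoffel nabla hq
      (mdifferentiableAt_of_contMDiffOn (isOpen_extChartAt_source c) hx hs) v
    have h2 := hpar _ (isOpen_extChartAt_source c) _ (contMDiffOn_frame c w) _ hx
      (frame c ((extChartAt 𝓘(ℝ, E) c).symm q) v)
    rw [sub_eq_zero] at h2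
    rw [h2] at h1
    rw [fderiv_clm_apply_const hd, eq_sub_iff_add_eq]
    refine Eq.trans h1 ?_
    rw [christoffel_apply nabla hq]
    simp only [chartEndomorphism, ContinuousLinearMap.comp_apply]
    rw [frame_coframe hx]
  complex_sq q hq v := by
    have hx := (extChartAt 𝓘(ℝ, E) c).map_target hq
    simp only [chartEndomorphism, ContinuousLinearMap.comp_apply]
    rw [frame_coframe hx, hJ.sq_eq_neg, map_neg, coframe_frame hx]
  complex_orthogonal q hq v w := by
    have hx := (extChartAt 𝓘(ℝ, E) c).map_target hq
    simp only [chartEndomorphism, ContinuousLinearMap.comp_apply, chartMetric_apply]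
    rw [frame_coframe hx, frame_coframe hx]
    exact hJ.orthogonal _ _ _

end KaehlerTransport

/-! ### Weyl connections and parallel line fields. -/

section Weyl

variable {E : Type*} [NormedAddCommGroup E] [NormedSpace ℝ E]
  {M : Type*} [TopologicalSpace M] [ChartedSpace E M]

section Algebra

variable [RiemannianBundle (fun x : M ↦ TangentSpace 𝓘(ℝ, E) x)]

lemma tangentMetric_add_left {x : M} (v w z : TangentSpace 𝓘(ℝ, E) x) :
    tangentMetric x (v + w) z = tangentMetric x v z + tangentMetric x w z :=
  congrArg (fun L : TangentSpace 𝓘(ℝ, E) x →L[ℝ] ℝ ↦ L z) ((tangentMetric x).map_add v w)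

lemma tangentMetric_sub_left {x : M} (v w z : TangentSpace 𝓘(ℝ, E) x) :
    tangentMetric x (v - w) z = tangentMetric x v z - tangentMetric x w z :=
  congrArg (fun L : TangentSpace 𝓘(ℝ, E) x →L[ℝ] ℝ ↦ L z) ((tangentMetric x).map_sub v w)

lemma tangentMetric_smul_left {x : M} (r : ℝ) (v z : TangentSpace 𝓘(ℝ, E) x) :
    tangentMetric x (r • v) z = r * tangentMetric x v z :=
  congrArg (fun L : TangentSpace 𝓘(ℝ, E) x →L[ℝ] ℝ ↦ L z) ((tangentMetric x).map_smul r v)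

lemma tangentMetric_smul_right {x : M} (r : ℝ) (v z : TangentSpace 𝓘(ℝ, E) x) :
    tangentMetric x v (r • z) = r * tangentMetric x v z :=
  (tangentMetric x v).map_smul r z

end Algebra

variable [IsManifold 𝓘(ℝ, E) ∞ M]

lemma exists_mdifferentiableAt_extension {x : M} (v : TangentSpace 𝓘(ℝ, E) x) :
    ∃ V : Π x : M, TangentSpace 𝓘(ℝ, E) x, MDifferentiableAt 𝓘(ℝ, E) 𝓘(ℝ, E).tangent
      (fun x ↦ (⟨x, V x⟩ : TangentBundle 𝓘(ℝ, E) M)) x ∧ V x = v :=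
  ⟨fun y ↦ frame x y (coframe x x v), mdifferentiableAt_frame (mem_extChartAt_source x) _,
    frame_coframe (mem_extChartAt_source x) v⟩

section Unit

variable [RiemannianBundle (fun x : M ↦ TangentSpace 𝓘(ℝ, E) x)]
  [IsContMDiffRiemannianBundle 𝓘(ℝ, E) ∞ E (fun x : M ↦ TangentSpace 𝓘(ℝ, E) x)]

/-- Near every point a smooth line distribution is spanned by a smooth unit vector field. -/
lemma IsSmoothDistribution.exists_unit {T : Π x : M, Submodule ℝ (TangentSpace 𝓘(ℝ, E) x)}
    (hT : IsSmoothDistribution T 1) (x₀ : M) :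
    ∃ U : Set M, IsOpen U ∧ x₀ ∈ U ∧ ∃ ξ : Π x : M, TangentSpace 𝓘(ℝ, E) x,
      ContMDiffOn 𝓘(ℝ, E) 𝓘(ℝ, E).tangent ∞
        (fun x ↦ (⟨x, ξ x⟩ : TangentBundle 𝓘(ℝ, E) M)) U ∧
      (∀ x ∈ U, tangentMetric x (ξ x) (ξ x) = 1) ∧
      ∀ x ∈ U, ∀ v, v ∈ T x ↔ ∃ r : ℝ, v = r • ξ x := by
  obtain ⟨U, hU, hx₀, X, hX, hspan⟩ := hT x₀
  have hne : ∀ x ∈ U, 0 < tangentMetric x (X 0 x) (X 0 x) := fun x hx ↦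
    tangentMetric_pos ((hspan x hx).1.ne_zero 0)
  refine ⟨U, hU, hx₀, fun x ↦ (√(tangentMetric x (X 0 x) (X 0 x)))⁻¹ • X 0 x, ?_, ?_, ?_⟩
  · have h1 := contMDiffOn_tangentMetric (hX 0) (hX 0)
    have h2 : ContMDiffOn 𝓘(ℝ, E) 𝓘(ℝ, ℝ) ∞
        (fun x ↦ (√(tangentMetric x (X 0 x) (X 0 x)))⁻¹) U := fun x hx ↦ by
      have h3 : ContDiffAt ℝ ∞ (fun t : ℝ ↦ (√t)⁻¹) (tangentMetric x (X 0 x) (X 0 x)) :=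
        (Real.contDiffAt_sqrt (hne x hx).ne').inv (Real.sqrt_pos.mpr (hne x hx)).ne'
      exact ContMDiffAt.comp_contMDiffWithinAt (g := fun t : ℝ ↦ (√t)⁻¹)
        (f := fun x ↦ tangentMetric x (X 0 x) (X 0 x)) x h3.contMDiffAt (h1 x hx)
    exact h2.smul_section (hX 0)
  · intro x hx
    have h := Real.mul_self_sqrt (hne x hx).le
    have h0 := (Real.sqrt_pos.mpr (hne x hx)).ne'
    rw [tangentMetric_smul_left, tangentMetric_smul_right]
    nth_rewrite 3 [← h]
    field_simp
  · intro x hx v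
    have h0 := (Real.sqrt_pos.mpr (hne x hx)).ne'
    rw [← (hspan x hx).2, Set.range_unique, Submodule.mem_span_singleton]
    constructor
    · rintro ⟨r, rfl⟩
      exact ⟨r * √(tangentMetric x (X 0 x) (X 0 x)), by
        rw [smul_smul, mul_assoc, mul_inv_cancel₀ h0, mul_one]; rfl⟩
    · rintro ⟨r, rfl⟩
      exact ⟨r * (√(tangentMetric x (X 0 x) (X 0 x)))⁻¹, by rw [smul_smul]; rfl⟩

end Unit

variable [FiniteDimensional ℝ E]

/-- Both connections have [V, W] as the antisymmetric part of their derivatives, so it drops out of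
the difference. -/
lemma difference_symm
    {D nabla : CovariantDerivative 𝓘(ℝ, E) E (TangentSpace 𝓘(ℝ, E) : M → Type _)}
    (hD : D.torsion = 0) (hnabla : nabla.torsion = 0) {x : M} (v w : TangentSpace 𝓘(ℝ, E) x) :
    D.difference nabla x v w = D.difference nabla x w v := by
  obtain ⟨V, hV, rfl⟩ := exists_mdifferentiableAt_extension v
  obtain ⟨W, hW, rfl⟩ := exists_mdifferentiableAt_extension w
  have h1 := D.torsion_eq_zero_iff.mp hD hV hW
  have h2 := nabla.torsion_eq_zero_iff.mp hnabla hV hW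
  have hdV : D.difference nabla x (V x) = D V x - nabla V x :=
    IsCovariantDerivativeOn.difference_apply _ _ (Set.mem_univ x) hV
  have hdW : D.difference nabla x (W x) = D W x - nabla W x :=
    IsCovariantDerivativeOn.difference_apply _ _ (Set.mem_univ x) hW
  rw [hdV, hdW, sub_apply, sub_apply, sub_eq_sub_iff_sub_eq_sub,
    ← neg_sub (D W x (V x)), ← neg_sub (nabla W x (V x)), h1, h2]

variable [RiemannianBundle (fun x : M ↦ TangentSpace 𝓘(ℝ, E) x)]
  [IsContMDiffRiemannianBundle 𝓘(ℝ, E) ∞ E (fun x : M ↦ TangentSpace 𝓘(ℝ, E) x)]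
  {D nabla : CovariantDerivative 𝓘(ℝ, E) E (TangentSpace 𝓘(ℝ, E) : M → Type _)}
  {θ : Π x : M, TangentSpace 𝓘(ℝ, E) x →L[ℝ] ℝ}

lemma IsLeeForm.tangentMetric_difference (hθ : IsLeeForm D θ) (hnabla : IsLeviCivita nabla)
    {x : M} (v w z : TangentSpace 𝓘(ℝ, E) x) :
    tangentMetric x (D.difference nabla x v z) w + tangentMetric x v (D.difference nabla x w z) =
      2 * θ x z * tangentMetric x v w := by
  obtain ⟨V, hV, rfl⟩ := exists_mdifferentiableAt_extension v
  obtain ⟨W, hW, rfl⟩ := exists_mdifferentiableAt_extension w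
  have hdV : D.difference nabla x (V x) = D V x - nabla V x :=
    IsCovariantDerivativeOn.difference_apply _ _ (Set.mem_univ x) hV
  have hdW : D.difference nabla x (W x) = D W x - nabla W x :=
    IsCovariantDerivativeOn.difference_apply _ _ (Set.mem_univ x) hW
  have h1 := derivMetricTensor_tangent D hV hW z
  have h2 := hnabla.mvfderiv_tangentMetric hV hW z
  have h3 := hθ.derivMetric x z (V x) (W x)
  rw [inner_eq_tangentMetric] at h3
  rw [hdV, hdW, sub_apply, sub_apply,
    tangentMetric_sub_left, tangentMetric_symm _ (_ - _), tangentMetric_sub_left,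
    tangentMetric_symm _ (V x), tangentMetric_symm _ (V x)]
  linarith

/-- The difference between a Weyl connection and the Levi-Civita connection. -/
lemma IsLeeForm.tangentMetric_difference_eq (hθ : IsLeeForm D θ) (hD : D.torsion = 0)
    (hnabla : IsLeviCivita nabla) {x : M} (v w z : TangentSpace 𝓘(ℝ, E) x) :
    tangentMetric x (D.difference nabla x v w) z = θ x w * tangentMetric x v z +
      θ x v * tangentMetric x w z - θ x z * tangentMetric x v w := by
  -- As in Koszul's formula: a tensor symmetric in its two arguments is recovered from three
  -- permuted instances of the metric condition, here `h1 + h2 - h3`.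
  have h1 := hθ.tangentMetric_difference hnabla v z w
  have h2 := hθ.tangentMetric_difference hnabla w z v
  have h3 := hθ.tangentMetric_difference hnabla v w z
  rw [tangentMetric_symm v] at h1
  rw [tangentMetric_symm w, difference_symm hD hnabla.torsion_eq_zero w v] at h2
  rw [tangentMetric_symm v (D.difference _ _ _ _), difference_symm hD hnabla.torsion_eq_zero v z,
    difference_symm hD hnabla.torsion_eq_zero w z] at h3
  rw [difference_symm hD hnabla.torsion_eq_zero v w, tangentMetric_symm v z,
    tangentMetric_symm w z] at *
  linarith

variable {U : Set M} {ξ : Π x : M, TangentSpace 𝓘(ℝ, E) x}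

/-- Write D_v ξ = rξ and subtract the difference tensor. As ξ has constant length, ∇_v ξ is
orthogonal to ξ; this forces r = θ(v), which cancels the component along ξ coming from the tensor.
-/
lemma IsLeeForm.tangentMetric_cov_unit (hθ : IsLeeForm D θ) (hD : D.torsion = 0)
    (hnabla : IsLeviCivita nabla) (hU : IsOpen U)
    (hξ : ContMDiffOn 𝓘(ℝ, E) 𝓘(ℝ, E).tangent ∞
      (fun x ↦ (⟨x, ξ x⟩ : TangentBundle 𝓘(ℝ, E) M)) U)
    (hunit : ∀ x ∈ U, tangentMetric x (ξ x) (ξ x) = 1)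
    (hpar : ∀ x ∈ U, ∀ v, ∃ r : ℝ, D ξ x v = r • ξ x)
    {x : M} (hx : x ∈ U) (v z : TangentSpace 𝓘(ℝ, E) x) :
    tangentMetric x (nabla ξ x v) z =
      -(θ x (ξ x)) * tangentMetric x v z + tangentMetric x v (ξ x) * θ x z := by
  have hξx := mdifferentiableAt_of_contMDiffOn hU hx hξ
  have hd : D.difference nabla x (ξ x) = D ξ x - nabla ξ x :=
    IsCovariantDerivativeOn.difference_apply _ _ (Set.mem_univ x) hξx
  obtain ⟨r, hr⟩ := hpar x hx v
  have hA : ∀ z, tangentMetric x (nabla ξ x v) z = r * tangentMetric x (ξ x) z -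
      (θ x v * tangentMetric x (ξ x) z + θ x (ξ x) * tangentMetric x v z -
        θ x z * tangentMetric x (ξ x) v) := fun z ↦ by
    rw [← hθ.tangentMetric_difference_eq hD hnabla, hd, sub_apply,
      tangentMetric_sub_left, hr, tangentMetric_smul_left]
    ring
  have hortho : tangentMetric x (nabla ξ x v) (ξ x) = 0 := by
    have h1 := hnabla.mvfderiv_tangentMetric hξx hξx v
    have h2 : (fun y ↦ tangentMetric y (ξ y) (ξ y)) =ᶠ[𝓝 x] fun _ ↦ (1 : ℝ) := by
      filter_upwards [hU.mem_nhds hx] with y hy using hunit y hy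
    have h3 : mvfderiv 𝓘(ℝ, E) (fun y ↦ tangentMetric y (ξ y) (ξ y)) x v = 0 := by
      rw [mvfderiv, h2.mfderiv_eq, mfderiv_const]
      rfl
    rw [h3, tangentMetric_symm (ξ x)] at h1
    linarith
  have hr' : r = θ x v := by
    have := hA (ξ x)
    rw [hortho, hunit x hx, tangentMetric_symm (ξ x) v] at this
    linarith
  rw [hA z, hr', tangentMetric_symm (ξ x) v]
  ring

/-- The metric dual of the Lee form, in terms of a unit vector field spanning a parallel line
distribution. -/
lemma IsLeeForm.tangentMetric_dual (hθ : IsLeeForm D θ) (hD : D.torsion = 0)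
    (hnabla : IsLeviCivita nabla) (hU : IsOpen U)
    (hξ : ContMDiffOn 𝓘(ℝ, E) 𝓘(ℝ, E).tangent ∞
      (fun x ↦ (⟨x, ξ x⟩ : TangentBundle 𝓘(ℝ, E) M)) U)
    (hunit : ∀ x ∈ U, tangentMetric x (ξ x) (ξ x) = 1)
    (hpar : ∀ x ∈ U, ∀ v, ∃ r : ℝ, D ξ x v = r • ξ x)
    {x : M} (hx : x ∈ U) (z : TangentSpace 𝓘(ℝ, E) x) :
    tangentMetric x (nabla ξ x (ξ x) + θ x (ξ x) • ξ x) z = θ x z := by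
  rw [tangentMetric_add_left, tangentMetric_smul_left,
    hθ.tangentMetric_cov_unit hD hnabla hU hξ hunit hpar hx, hunit x hx]
  ring

/-- For v orthogonal to ξ this reads ∇_v ξ = -θ(ξ) v: the hyperplanes orthogonal to ξ are umbilical,
with factor governed by θ(ξ). -/
lemma IsLeeForm.cov_unit (hθ : IsLeeForm D θ) (hD : D.torsion = 0)
    (hnabla : IsLeviCivita nabla) (hU : IsOpen U)
    (hξ : ContMDiffOn 𝓘(ℝ, E) 𝓘(ℝ, E).tangent ∞
      (fun x ↦ (⟨x, ξ x⟩ : TangentBundle 𝓘(ℝ, E) M)) U)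
    (hunit : ∀ x ∈ U, tangentMetric x (ξ x) (ξ x) = 1)
    (hpar : ∀ x ∈ U, ∀ v, ∃ r : ℝ, D ξ x v = r • ξ x)
    {x : M} (hx : x ∈ U) {Z : TangentSpace 𝓘(ℝ, E) x}
    (hZ : ∀ z, tangentMetric x Z z = θ x z) (v : TangentSpace 𝓘(ℝ, E) x) :
    nabla ξ x v = -(tangentMetric x Z (ξ x)) • v + tangentMetric x v (ξ x) • Z := by
  refine eq_of_tangentMetric_eq fun z ↦ ?_
  rw [hθ.tangentMetric_cov_unit hD hnabla hU hξ hunit hpar hx, tangentMetric_add_left,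
    tangentMetric_smul_left, tangentMetric_smul_left, hZ, hZ]

end Weyl

/-! ### Integration over chart domains and the local divergence theorem. -/

section DivergenceTheorem

open MeasureTheory

variable {E : Type*} [NormedAddCommGroup E] [NormedSpace ℝ E]
  {M : Type*} [TopologicalSpace M] [ChartedSpace E M]

lemma tsupport_mvfderiv_apply_subset (f : M → ℝ) (V : Π x : M, TangentSpace 𝓘(ℝ, E) x) :
    tsupport (fun x ↦ mvfderiv 𝓘(ℝ, E) f x (V x)) ⊆ tsupport f := by
  refine closure_minimal (fun x hx ↦ ?_) (isClosed_tsupport f)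
  by_contra hne
  refine hx ?_
  have h := notMem_tsupport_iff_eventuallyEq.mp hne
  have h' : f =ᶠ[𝓝 x] fun _ ↦ (0 : ℝ) := h
  simp only [mvfderiv, h'.mfderiv_eq, mfderiv_const]
  rfl

lemma continuous_of_continuousOn_charts {f : M → ℝ}
    (hf : ∀ c : M, ContinuousOn (f ∘ (extChartAt 𝓘(ℝ, E) c).symm)
      (extChartAt 𝓘(ℝ, E) c).target) : Continuous f := by
  rw [continuous_iff_continuousAt]
  intro x
  have hx := mem_extChartAt_source (I := 𝓘(ℝ, E)) x
  have h := ((hf x).comp (continuousOn_extChartAt (I := 𝓘(ℝ, E)) x)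
    (extChartAt 𝓘(ℝ, E) x).mapsTo).continuousAt ((isOpen_extChartAt_source x).mem_nhds hx)
  refine h.congr ?_
  filter_upwards [(isOpen_extChartAt_source (I := 𝓘(ℝ, E)) x).mem_nhds hx] with y hy
  rw [Function.comp_apply, Function.comp_apply, (extChartAt 𝓘(ℝ, E) x).left_inv hy]

lemma exists_isCompact_chart [CompactSpace M] {c : M} {f : M → ℝ}
    (hf : tsupport f ⊆ (extChartAt 𝓘(ℝ, E) c).source) :
    ∃ K : Set E, IsCompact K ∧ K ⊆ (extChartAt 𝓘(ℝ, E) c).target ∧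
      ∀ p ∈ (extChartAt 𝓘(ℝ, E) c).target \ K, f ((extChartAt 𝓘(ℝ, E) c).symm p) = 0 := by
  refine ⟨extChartAt 𝓘(ℝ, E) c '' tsupport f, (isClosed_tsupport f).isCompact.image_of_continuousOn
    ((continuousOn_extChartAt c).mono hf), ?_, fun p hp ↦ ?_⟩
  · rintro _ ⟨x, hx, rfl⟩
    exact (extChartAt 𝓘(ℝ, E) c).map_source (hf hx)
  · refine image_eq_zero_of_notMem_tsupport fun h ↦ hp.2 ⟨_, h, ?_⟩
    exact (extChartAt 𝓘(ℝ, E) c).right_inv hp.1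

section

variable [RiemannianBundle (fun x : M ↦ TangentSpace 𝓘(ℝ, E) x)]

lemma chartMetric_extChartAt {c x : M} (hx : x ∈ (extChartAt 𝓘(ℝ, E) c).source) (v w : E) :
    chartMetric c (extChartAt 𝓘(ℝ, E) c x) v w =
      tangentMetric x (frame c x v) (frame c x w) := by
  rw [chartMetric_apply, (extChartAt 𝓘(ℝ, E) c).left_inv hx]

variable {ι : Type*} [Fintype ι] [DecidableEq ι] (b : Module.Basis ι ℝ E)
  [MeasurableSpace E] (μ : Measure E)

/-- The Riemannian integral, over the domain of the chart at `c`, of a function. -/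
def chartIntegral (c : M) (f : M → ℝ) : ℝ :=
  ∫ p in (extChartAt 𝓘(ℝ, E) c).target,
    density b (chartMetric c p) * f ((extChartAt 𝓘(ℝ, E) c).symm p) ∂μ

lemma chartIntegral_eq_setIntegral [BorelSpace E] {c : M} {S : Set M} {f : M → ℝ}
    (hS : ∀ x ∉ S, f x = 0) :
    chartIntegral b μ c f =
      ∫ p in (extChartAt 𝓘(ℝ, E) c).target ∩ (extChartAt 𝓘(ℝ, E) c).symm ⁻¹' S,
        density b (chartMetric c p) * f ((extChartAt 𝓘(ℝ, E) c).symm p) ∂μ := by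
  have hm := (isOpen_extChartAt_target (I := 𝓘(ℝ, E)) c).measurableSet
  rw [chartIntegral]
  refine setIntegral_eq_of_subset_of_forall_sdiff_eq_zero hm Set.inter_subset_left fun p hp ↦ ?_
  rw [hS _ fun h ↦ hp.2 ⟨hp.1, h⟩, mul_zero]

end

variable [IsManifold 𝓘(ℝ, E) ∞ M]

section Fields

lemma mvfderiv_eq_fderiv_chart {c x : M} (hx : x ∈ (extChartAt 𝓘(ℝ, E) c).source) {f : M → ℝ}
    (hf : MDifferentiableAt 𝓘(ℝ, E) 𝓘(ℝ, ℝ) f x) (v : TangentSpace 𝓘(ℝ, E) x) :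
    mvfderiv 𝓘(ℝ, E) f x v =
      fderiv ℝ (f ∘ (extChartAt 𝓘(ℝ, E) c).symm) (extChartAt 𝓘(ℝ, E) c x) (coframe c x v) := by
  have hp := (extChartAt 𝓘(ℝ, E) c).map_source hx
  have hxp := (extChartAt 𝓘(ℝ, E) c).left_inv hx
  rw [fderiv_comp_extChartAt_symm hp (by rwa [hxp]), hxp, frame_coframe hx]

variable {V : Π x : M, TangentSpace 𝓘(ℝ, E) x}

lemma contDiffOn_chartField (hV : ContMDiff 𝓘(ℝ, E) 𝓘(ℝ, E).tangent ∞
      (fun x ↦ (⟨x, V x⟩ : TangentBundle 𝓘(ℝ, E) M))) (c : M) :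
    ContDiffOn ℝ ∞ ((fun y ↦ coframe c y (V y)) ∘ (extChartAt 𝓘(ℝ, E) c).symm)
      (extChartAt 𝓘(ℝ, E) c).target :=
  (contDiffOn_comp_extChartAt_symm (contMDiffOn_coframe (isOpen_extChartAt_source c) subset_rfl
    hV.contMDiffOn)).mono fun _ hp ↦ ⟨hp, (extChartAt 𝓘(ℝ, E) c).map_target hp⟩

lemma contDiffOn_comp_chart {f : M → ℝ} (hf : ContMDiff 𝓘(ℝ, E) 𝓘(ℝ, ℝ) ∞ f) (c : M) :
    ContDiffOn ℝ ∞ (f ∘ (extChartAt 𝓘(ℝ, E) c).symm) (extChartAt 𝓘(ℝ, E) c).target :=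
  (contDiffOn_comp_extChartAt_symm (hf.contMDiffOn (s := Set.univ))).mono fun _ hp ↦
    ⟨hp, Set.mem_univ _⟩

lemma continuous_mvfderiv_apply {f : M → ℝ} (hf : ContMDiff 𝓘(ℝ, E) 𝓘(ℝ, ℝ) ∞ f)
    (hV : ContMDiff 𝓘(ℝ, E) 𝓘(ℝ, E).tangent ∞
      (fun x ↦ (⟨x, V x⟩ : TangentBundle 𝓘(ℝ, E) M))) :
    Continuous (fun x ↦ mvfderiv 𝓘(ℝ, E) f x (V x)) := by
  refine continuous_of_continuousOn_charts (E := E) fun c ↦ ?_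
  have h1 := ((contDiffOn_comp_chart hf c).fderiv_of_isOpen (isOpen_extChartAt_target c)
    (m := ∞) (by simp)).clm_apply (contDiffOn_chartField hV c)
  refine h1.continuousOn.congr fun p hp ↦ ?_
  have hx := (extChartAt 𝓘(ℝ, E) c).map_target hp
  rw [Function.comp_apply, mvfderiv_eq_fderiv_chart hx (hf.mdifferentiable (by simp) _),
    (extChartAt 𝓘(ℝ, E) c).right_inv hp]
  rfl

end Fields

section ChartIntegral

variable [RiemannianBundle (fun x : M ↦ TangentSpace 𝓘(ℝ, E) x)]
  {ι : Type*} [Fintype ι] [DecidableEq ι] (b : Module.Basis ι ℝ E)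

lemma density_chartMetric_pos {c : M} {p : E} (hp : p ∈ (extChartAt 𝓘(ℝ, E) c).target) :
    0 < density b (chartMetric c p) :=
  density_pos b (chartMetric_symm c p) fun _ hv ↦ chartMetric_pos hp hv

/-- The metric in one chart is the pull-back of the metric in the other by the differential of the
transition map. -/
lemma density_chartMetric_change {c c' x : M} (hx : x ∈ (extChartAt 𝓘(ℝ, E) c).source)
    (hx' : x ∈ (extChartAt 𝓘(ℝ, E) c').source) :
    density b (chartMetric c (extChartAt 𝓘(ℝ, E) c x)) =
      |(coframe c' x ∘L frame c x : E →L[ℝ] E).det| *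
        density b (chartMetric c' (extChartAt 𝓘(ℝ, E) c' x)) := by
  rw [← density_bilinearComp]
  congr 1
  ext v w
  rw [ContinuousLinearMap.bilinearComp_apply, chartMetric_extChartAt hx,
    chartMetric_extChartAt hx', ContinuousLinearMap.comp_apply, ContinuousLinearMap.comp_apply,
    frame_coframe hx', frame_coframe hx']

section

variable [FiniteDimensional ℝ E]
  [IsContMDiffRiemannianBundle 𝓘(ℝ, E) ∞ E (fun x : M ↦ TangentSpace 𝓘(ℝ, E) x)]

lemma contDiffOn_density_chartMetric (c : M) :
    ContDiffOn ℝ ∞ (fun p ↦ density b (chartMetric c p)) (extChartAt 𝓘(ℝ, E) c).target :=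
  contDiffOn_density b (contDiffOn_chartMetric c) (fun q _ ↦ chartMetric_symm c q)
    fun _ hq _ hv ↦ chartMetric_pos hq hv

lemma continuousOn_chartIntegrand {f : M → ℝ} (hf : Continuous f) (c : M) :
    ContinuousOn (fun p ↦ density b (chartMetric c p) * f ((extChartAt 𝓘(ℝ, E) c).symm p))
      (extChartAt 𝓘(ℝ, E) c).target :=
  (contDiffOn_density_chartMetric b c).continuousOn.mul
    (hf.comp_continuousOn (continuousOn_extChartAt_symm c))

end

variable [MeasurableSpace E] (μ : Measure E)

variable [BorelSpace E]

lemma chartIntegral_nonpos {c : M} {f : M → ℝ} (hf0 : ∀ x, f x ≤ 0) :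
    chartIntegral b μ c f ≤ 0 :=
  setIntegral_nonpos (isOpen_extChartAt_target c).measurableSet fun _ hp ↦
    mul_nonpos_of_nonneg_of_nonpos (density_chartMetric_pos b hp).le (hf0 _)

variable [FiniteDimensional ℝ E] [μ.IsAddHaarMeasure]

/-- The Riemannian integral does not depend on the chart. -/
lemma chartIntegral_change {c c' : M} {f : M → ℝ}
    (hf : tsupport f ⊆ (extChartAt 𝓘(ℝ, E) c).source)
    (hf' : tsupport f ⊆ (extChartAt 𝓘(ℝ, E) c').source) :
    chartIntegral b μ c f = chartIntegral b μ c' f := by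
  have h0 : ∀ x ∉ (extChartAt 𝓘(ℝ, E) c).source, f x = 0 := fun x hx ↦
    image_eq_zero_of_notMem_tsupport fun h ↦ hx (hf h)
  have h0' : ∀ x ∉ (extChartAt 𝓘(ℝ, E) c').source, f x = 0 := fun x hx ↦
    image_eq_zero_of_notMem_tsupport fun h ↦ hx (hf' h)
  rw [chartIntegral_eq_setIntegral b μ h0', chartIntegral_eq_setIntegral b μ h0]
  set s := (extChartAt 𝓘(ℝ, E) c).target ∩
    (extChartAt 𝓘(ℝ, E) c).symm ⁻¹' (extChartAt 𝓘(ℝ, E) c').source with hs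
  have hsm : MeasurableSet s := ((continuousOn_extChartAt_symm c).isOpen_inter_preimage
    (isOpen_extChartAt_target c) (isOpen_extChartAt_source c')).measurableSet
  have himage : (extChartAt 𝓘(ℝ, E) c') ∘ (extChartAt 𝓘(ℝ, E) c).symm '' s =
      (extChartAt 𝓘(ℝ, E) c').target ∩
        (extChartAt 𝓘(ℝ, E) c').symm ⁻¹' (extChartAt 𝓘(ℝ, E) c).source := by
    ext q
    constructor
    · rintro ⟨p, hp, rfl⟩
      refine ⟨(extChartAt 𝓘(ℝ, E) c').map_source hp.2, ?_⟩
      rw [Set.mem_preimage, Function.comp_apply, (extChartAt 𝓘(ℝ, E) c').left_inv hp.2]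
      exact (extChartAt 𝓘(ℝ, E) c).map_target hp.1
    · intro hq
      refine ⟨extChartAt 𝓘(ℝ, E) c ((extChartAt 𝓘(ℝ, E) c').symm q),
        ⟨(extChartAt 𝓘(ℝ, E) c).map_source hq.2, ?_⟩, ?_⟩
      · rw [Set.mem_preimage, (extChartAt 𝓘(ℝ, E) c).left_inv hq.2]
        exact (extChartAt 𝓘(ℝ, E) c').map_target hq.1
      · rw [Function.comp_apply, (extChartAt 𝓘(ℝ, E) c).left_inv hq.2,
          (extChartAt 𝓘(ℝ, E) c').right_inv hq.1]
  have hinj : Set.InjOn ((extChartAt 𝓘(ℝ, E) c') ∘ (extChartAt 𝓘(ℝ, E) c).symm) s :=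
    fun p hp q hq h ↦ (extChartAt 𝓘(ℝ, E) c).symm.injOn hp.1 hq.1
      ((extChartAt 𝓘(ℝ, E) c').injOn hp.2 hq.2 h)
  have hder : ∀ p ∈ s, HasFDerivWithinAt
      ((extChartAt 𝓘(ℝ, E) c') ∘ (extChartAt 𝓘(ℝ, E) c).symm)
      (coframe c' ((extChartAt 𝓘(ℝ, E) c).symm p) ∘L
        frame c ((extChartAt 𝓘(ℝ, E) c).symm p) : E →L[ℝ] E) s p := fun p hp ↦ by
    have hm : MDifferentiableAt 𝓘(ℝ, E) 𝓘(ℝ, E) (extChartAt 𝓘(ℝ, E) c')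
        ((extChartAt 𝓘(ℝ, E) c).symm p) := by
      have h2 := hp.2
      rw [Set.mem_preimage, extChartAt_source] at h2
      exact mdifferentiableAt_extChartAt h2
    have hd := (differentiableAt_comp_extChartAt_symm hp.1 hm).hasFDerivAt
    have he : fderiv ℝ ((extChartAt 𝓘(ℝ, E) c') ∘ (extChartAt 𝓘(ℝ, E) c).symm) p =
        (coframe c' ((extChartAt 𝓘(ℝ, E) c).symm p) ∘L
          frame c ((extChartAt 𝓘(ℝ, E) c).symm p) : E →L[ℝ] E) := by
      ext v
      exact fderiv_comp_extChartAt_symm hp.1 hm v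
    rw [he] at hd
    exact hd.hasFDerivWithinAt
  -- The Jacobian of the transition map is the same factor by which the densities differ.
  rw [← himage, integral_image_eq_integral_abs_det_fderiv_smul μ hsm hder hinj]
  refine setIntegral_congr_fun hsm fun p hp ↦ ?_
  have hx := (extChartAt 𝓘(ℝ, E) c).map_target hp.1
  have h := density_chartMetric_change b hx hp.2
  rw [(extChartAt 𝓘(ℝ, E) c).right_inv hp.1] at h
  simp only [Function.comp_apply, smul_eq_mul]
  rw [h, (extChartAt 𝓘(ℝ, E) c').left_inv hp.2, mul_assoc]

variable [IsContMDiffRiemannianBundle 𝓘(ℝ, E) ∞ E (fun x : M ↦ TangentSpace 𝓘(ℝ, E) x)]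
  [CompactSpace M]

lemma integrableOn_chartIntegrand {c : M} {f : M → ℝ} (hf : Continuous f)
    (hfc : tsupport f ⊆ (extChartAt 𝓘(ℝ, E) c).source) :
    IntegrableOn (fun p ↦ density b (chartMetric c p) * f ((extChartAt 𝓘(ℝ, E) c).symm p))
      (extChartAt 𝓘(ℝ, E) c).target μ := by
  obtain ⟨K, hK, hKt, h0⟩ := exists_isCompact_chart hfc
  exact (((continuousOn_chartIntegrand b hf c).mono hKt).integrableOn_compact
    hK).of_forall_sdiff_eq_zero
    (isOpen_extChartAt_target c).measurableSet fun p hp ↦ by rw [h0 p hp, mul_zero]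

lemma chartIntegral_add {c : M} {f g : M → ℝ} (hf : Continuous f)
    (hfc : tsupport f ⊆ (extChartAt 𝓘(ℝ, E) c).source) (hg : Continuous g)
    (hgc : tsupport g ⊆ (extChartAt 𝓘(ℝ, E) c).source) :
    chartIntegral b μ c (fun x ↦ f x + g x) = chartIntegral b μ c f + chartIntegral b μ c g := by
  simp only [chartIntegral, mul_add]
  exact integral_add (integrableOn_chartIntegrand b μ hf hfc)
    (integrableOn_chartIntegrand b μ hg hgc)

lemma chartIntegral_sum {c : M} {κ : Type*} [Fintype κ] {f : κ → M → ℝ}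
    (hf : ∀ i, Continuous (f i))
    (hfc : ∀ i, tsupport (f i) ⊆ (extChartAt 𝓘(ℝ, E) c).source) :
    chartIntegral b μ c (fun x ↦ ∑ i, f i x) = ∑ i, chartIntegral b μ c (f i) := by
  simp only [chartIntegral, Finset.mul_sum]
  exact integral_finsetSum _ fun i _ ↦ integrableOn_chartIntegrand b μ (hf i) (hfc i)

lemma eq_zero_of_chartIntegral_eq_zero {c : M} {f : M → ℝ} (hf : Continuous f)
    (hfc : tsupport f ⊆ (extChartAt 𝓘(ℝ, E) c).source) (hf0 : ∀ x, f x ≤ 0)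
    (h : chartIntegral b μ c f = 0) (x : M) : f x = 0 := by
  by_cases hx : x ∈ (extChartAt 𝓘(ℝ, E) c).source
  swap
  · exact image_eq_zero_of_notMem_tsupport fun h ↦ hx (hfc h)
  have hm := (isOpen_extChartAt_target (I := 𝓘(ℝ, E)) c).measurableSet
  have h1 : ∫ p in (extChartAt 𝓘(ℝ, E) c).target,
      -(density b (chartMetric c p) * f ((extChartAt 𝓘(ℝ, E) c).symm p)) ∂μ = 0 := by
    rw [integral_neg, neg_eq_zero]; exact h
  rw [setIntegral_eq_zero_iff_of_nonneg_ae ((ae_restrict_iff' hm).mpr (.of_forall fun p hp ↦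
    neg_nonneg.mpr (mul_nonpos_of_nonneg_of_nonpos (density_chartMetric_pos b hp).le (hf0 _))))
    (integrableOn_chartIntegrand b μ hf hfc).neg] at h1
  -- Haar measure charges nonempty open sets, so a continuous function vanishing almost everywhere
  -- on the target vanishes on all of it.
  have h2 := Measure.eqOn_open_of_ae_eq h1 (isOpen_extChartAt_target c)
    (continuousOn_chartIntegrand b hf c).neg continuousOn_const
    ((extChartAt 𝓘(ℝ, E) c).map_source hx)
  have h3 := (density_chartMetric_pos b ((extChartAt 𝓘(ℝ, E) c).map_source hx)).ne'
  simp only [(extChartAt 𝓘(ℝ, E) c).left_inv hx] at h2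
  exact (mul_eq_zero.mp (neg_eq_zero.mp h2)).resolve_left h3

end ChartIntegral

section Divergence

variable [FiniteDimensional ℝ E]

/-- The divergence of a vector field: the trace of its covariant derivative. -/
def divergence (nabla : CovariantDerivative 𝓘(ℝ, E) E (TangentSpace 𝓘(ℝ, E) : M → Type _))
    (V : Π x : M, TangentSpace 𝓘(ℝ, E) x) (x : M) : ℝ :=
  traceL E (coframe x x ∘L nabla V x ∘L frame x x)

variable {nabla : CovariantDerivative 𝓘(ℝ, E) E (TangentSpace 𝓘(ℝ, E) : M → Type _)}
  {V : Π x : M, TangentSpace 𝓘(ℝ, E) x}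

/-- The definition uses the chart centred at `x`; another chart conjugates the endomorphism and
keeps its trace. -/
lemma divergence_eq_trace {c x : M} (hx : x ∈ (extChartAt 𝓘(ℝ, E) c).source) :
    divergence nabla V x = traceL E (coframe c x ∘L nabla V x ∘L frame c x) := by
  have hx' := mem_extChartAt_source (I := 𝓘(ℝ, E)) x
  have h := traceL_comp_comm (coframe x x ∘L frame c x : E →L[ℝ] E)
    (coframe c x ∘L nabla V x ∘L frame x x : E →L[ℝ] E)
  have e1 : (coframe x x ∘L frame c x : E →L[ℝ] E) ∘L
      (coframe c x ∘L nabla V x ∘L frame x x : E →L[ℝ] E) =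
      coframe x x ∘L nabla V x ∘L frame x x := by
    ext v
    simp only [ContinuousLinearMap.comp_apply]
    rw [frame_coframe hx]
  have e2 : (coframe c x ∘L nabla V x ∘L frame x x : E →L[ℝ] E) ∘L
      (coframe x x ∘L frame c x : E →L[ℝ] E) = coframe c x ∘L nabla V x ∘L frame c x := by
    ext v
    simp only [ContinuousLinearMap.comp_apply]
    rw [frame_coframe hx']
  rw [e1, e2] at h
  exact h

lemma divergence_symm_apply {c : M} {p : E} (hp : p ∈ (extChartAt 𝓘(ℝ, E) c).target)
    (hV : MDifferentiableAt 𝓘(ℝ, E) 𝓘(ℝ, E).tangent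
      (fun x ↦ (⟨x, V x⟩ : TangentBundle 𝓘(ℝ, E) M)) ((extChartAt 𝓘(ℝ, E) c).symm p)) :
    divergence nabla V ((extChartAt 𝓘(ℝ, E) c).symm p) = traceL E
      (covDeriv (christoffel nabla c)
        ((fun y ↦ coframe c y (V y)) ∘ (extChartAt 𝓘(ℝ, E) c).symm) p) := by
  rw [divergence_eq_trace ((extChartAt 𝓘(ℝ, E) c).map_target hp)]
  congr 1
  ext v
  exact (covDeriv_christoffel nabla hp hV v).symm

lemma continuous_divergence [T2Space M] (hnabla : nabla.ContMDiffCovariantDerivative ∞)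
    (hV : ContMDiff 𝓘(ℝ, E) 𝓘(ℝ, E).tangent ∞
      (fun x ↦ (⟨x, V x⟩ : TangentBundle 𝓘(ℝ, E) M))) :
    Continuous (divergence nabla V) := by
  refine continuous_of_continuousOn_charts (E := E) fun c ↦ ?_
  have h := (traceL E).continuous.comp_continuousOn (contDiffOn_covDeriv
    (isOpen_extChartAt_target c) (contDiffOn_christoffel nabla hnabla c)
    (contDiffOn_chartField hV c)).continuousOn
  exact h.congr fun p hp ↦ divergence_symm_apply hp (hV.mdifferentiable (by simp) _)

variable [RiemannianBundle (fun x : M ↦ TangentSpace 𝓘(ℝ, E) x)]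
  [IsContMDiffRiemannianBundle 𝓘(ℝ, E) ∞ E (fun x : M ↦ TangentSpace 𝓘(ℝ, E) x)]
  {ι : Type*} [Fintype ι] [DecidableEq ι] (b : Module.Basis ι ℝ E)
  [MeasurableSpace E] [BorelSpace E] (μ : Measure E) [μ.IsAddHaarMeasure]
  [CompactSpace M]

/-- The divergence theorem for vector fields supported in a chart. -/
lemma chartIntegral_divergence (hnabla : IsLeviCivita nabla)
    (hV : ContMDiff 𝓘(ℝ, E) 𝓘(ℝ, E).tangent ∞
      (fun x ↦ (⟨x, V x⟩ : TangentBundle 𝓘(ℝ, E) M)))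
    {ρ : M → ℝ} (hρ : ContMDiff 𝓘(ℝ, E) 𝓘(ℝ, ℝ) ∞ ρ) {c : M}
    (hρc : tsupport ρ ⊆ (extChartAt 𝓘(ℝ, E) c).source) :
    chartIntegral b μ c (fun x ↦ ρ x * divergence nabla V x + mvfderiv 𝓘(ℝ, E) ρ x (V x)) = 0 := by
  obtain ⟨K, hK, hKt, h0⟩ := exists_isCompact_chart hρc
  have hopen := isOpen_extChartAt_target (I := 𝓘(ℝ, E)) c
  have hρ' := contDiffOn_comp_chart hρ c
  have hV' := contDiffOn_chartField hV c
  -- The Euclidean theorem is applied to density · ρ · V, which vanishes off a compact part of the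
  -- chart.
  have hW := ((contDiffOn_density_chartMetric b c).smul (hρ'.smul hV')).of_le
    (m := 1) (by exact_mod_cast le_top)
  have h := setIntegral_trace_fderiv_eq_zero μ hopen hK hKt hW fun p hp ↦ by
    rw [Pi.smul_apply', Pi.smul_apply', Function.comp_apply, h0 p hp, zero_smul, smul_zero]
  refine Eq.trans (setIntegral_congr_fun hopen.measurableSet fun p hp ↦ ?_) h
  have hx := (extChartAt 𝓘(ℝ, E) c).map_target hp
  have hd := trace_fderiv_smul_density b (differentiableAt_chartMetric hp)
    (chartMetric_symm c p) (fun _ hv ↦ chartMetric_pos hp hv)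
    (hnabla.christoffel_symm hp) (hnabla.fderiv_chartMetric hp)
    ((hρ'.contDiffAt (hopen.mem_nhds hp)).differentiableAt (by simp))
    ((hV'.contDiffAt (hopen.mem_nhds hp)).differentiableAt (by simp))
  refine Eq.trans ?_ hd.symm
  simp only
  rw [divergence_symm_apply hp (hV.mdifferentiable (by simp) _),
    mvfderiv_eq_fderiv_chart hx (hρ.mdifferentiable (by simp) _),
    (extChartAt 𝓘(ℝ, E) c).right_inv hp]
  rfl

end Divergence

end DivergenceTheorem

/-! ### The divergence argument on a compact manifold. -/

section Global

open MeasureTheory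

variable {E : Type*} [NormedAddCommGroup E] [NormedSpace ℝ E] [FiniteDimensional ℝ E]
  {M : Type*} [TopologicalSpace M] [ChartedSpace E M] [IsManifold 𝓘(ℝ, E) ∞ M]
  [RiemannianBundle (fun x : M ↦ TangentSpace 𝓘(ℝ, E) x)]
  [IsContMDiffRiemannianBundle 𝓘(ℝ, E) ∞ E (fun x : M ↦ TangentSpace 𝓘(ℝ, E) x)]
  [T2Space M] [CompactSpace M]

/-- On a compact Riemannian manifold, a vector field whose divergence is nowhere positive is
divergence-free. -/
lemma divergence_eq_zero_of_nonpos
    {nabla : CovariantDerivative 𝓘(ℝ, E) E (TangentSpace 𝓘(ℝ, E) : M → Type _)}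
    (hnabla : IsLeviCivita nabla) {V : Π x : M, TangentSpace 𝓘(ℝ, E) x}
    (hV : ContMDiff 𝓘(ℝ, E) 𝓘(ℝ, E).tangent ∞
      (fun x ↦ (⟨x, V x⟩ : TangentBundle 𝓘(ℝ, E) M)))
    (hdiv : ∀ x, divergence nabla V x ≤ 0) (x : M) : divergence nabla V x = 0 := by
  let _ : MeasurableSpace E := borel E
  have : BorelSpace E := ⟨rfl⟩
  let b := Module.finBasis ℝ E
  let μ : Measure E := Measure.addHaar
  obtain ⟨t, ht⟩ := isCompact_univ.elim_finite_subcover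
    (fun c : M ↦ (extChartAt 𝓘(ℝ, E) c).source) (fun c ↦ isOpen_extChartAt_source c)
    fun c _ ↦ Set.mem_iUnion.mpr ⟨c, mem_extChartAt_source c⟩
  obtain ⟨ρ, hρ⟩ := SmoothPartitionOfUnity.exists_isSubordinate 𝓘(ℝ, E) isClosed_univ
    (fun c : t ↦ (extChartAt 𝓘(ℝ, E) (c : M)).source) (fun c ↦ isOpen_extChartAt_source (c : M))
    (by simpa [Set.iUnion_subtype] using ht)
  have hsum : ∀ x, ∑ i, ρ i x = 1 := fun x ↦ by
    rw [← finsum_eq_sum_of_fintype]; exact ρ.sum_eq_one (Set.mem_univ x)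
  have hρs : ∀ i, ContMDiff 𝓘(ℝ, E) 𝓘(ℝ, ℝ) ∞ (ρ i) := fun i ↦ (ρ i).contMDiff
  let F := divergence nabla V
  have hF : Continuous F := continuous_divergence hnabla.smooth hV
  let δ : t → M → ℝ := fun i x ↦ mvfderiv 𝓘(ℝ, E) (ρ i) x (V x)
  have hδ : ∀ i, Continuous (δ i) := fun i ↦ continuous_mvfderiv_apply (hρs i) hV
  have hδc : ∀ i, tsupport (δ i) ⊆ (extChartAt 𝓘(ℝ, E) (i : M)).source := fun i ↦
    (tsupport_mvfderiv_apply_subset _ _).trans (hρ i)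
  -- The cut-offs sum to 1, so their derivatives along `V` sum to 0.
  have hδsum : ∀ x, ∑ i, δ i x = 0 := fun x ↦ by
    have h1 : mvfderiv 𝓘(ℝ, E) (fun y ↦ ∑ i, ρ i y) x (V x) = 0 := by
      rw [funext hsum, mvfderiv, mfderiv_const]
      rfl
    rw [← h1, mvfderiv_eq_fderiv_chart (mem_extChartAt_source x)]
    · have : (fun y ↦ ∑ i, ρ i y) ∘ (extChartAt 𝓘(ℝ, E) x).symm =
        fun p ↦ ∑ i, (ρ i ∘ (extChartAt 𝓘(ℝ, E) x).symm) p := rfl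
      rw [this, fderiv_fun_sum, sum_apply]
      · exact Finset.sum_congr rfl fun i _ ↦ mvfderiv_eq_fderiv_chart (mem_extChartAt_source x)
          ((hρs i).mdifferentiable (by simp) _) _
      · exact fun i _ ↦ differentiableAt_comp_extChartAt_symm (mem_extChartAt_target x)
          ((hρs i).mdifferentiable (by simp) _)
    · simp only [hsum]
      exact mdifferentiableAt_const
  -- A second use of the partition, 1 = ∑ ρ_j, splits the error `δ i` into pieces supported in two
  -- charts at once, which can then be moved from chart `i` to chart `j`.
  have hlocal : ∀ i : t, chartIntegral b μ (i : M) (fun x ↦ ρ i x * F x) =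
      -∑ j, chartIntegral b μ (i : M) (fun x ↦ ρ j x * δ i x) := fun i ↦ by
    have h1 := chartIntegral_divergence b μ hnabla hV (hρs i) (hρ i)
    have h2 := chartIntegral_add b μ ((hρs i).continuous.mul hF)
      ((tsupport_mul_subset_left (g := F)).trans (hρ i)) (hδ i) (hδc i)
    rw [← chartIntegral_sum b μ (f := fun j x ↦ ρ j x * δ i x)
      (fun j ↦ (hρs j).continuous.mul (hδ i))
      (fun j ↦ (tsupport_mul_subset_right (f := ρ j)).trans (hδc i))]
    simp only [← Finset.sum_mul, hsum, one_mul]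
    exact eq_neg_of_add_eq_zero_left (h2.symm.trans h1)
  have htotal : ∑ i : t, chartIntegral b μ (i : M) (fun x ↦ ρ i x * F x) = 0 := by
    rw [Finset.sum_congr rfl fun i _ ↦ hlocal i, Finset.sum_neg_distrib, Finset.sum_comm,
      neg_eq_zero]
    refine Finset.sum_eq_zero fun j _ ↦ ?_
    have h1 : ∀ i, tsupport (fun x ↦ ρ j x * δ i x) ⊆ (extChartAt 𝓘(ℝ, E) (j : M)).source :=
      fun i ↦ (tsupport_mul_subset_left (g := δ i)).trans (hρ j)
    -- For fixed `j` all terms now live in the single chart `j`, where the sum over `i` can be taken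
    -- under the integral and vanishes.
    rw [Finset.sum_congr rfl fun i _ ↦ chartIntegral_change b μ
      ((tsupport_mul_subset_right (f := ρ j)).trans (hδc i)) (h1 i),
      ← chartIntegral_sum b μ (f := fun i x ↦ ρ j x * δ i x)
        (fun i ↦ (hρs j).continuous.mul (hδ i)) h1]
    simp only [← Finset.mul_sum, hδsum, mul_zero]
    simp [chartIntegral]
  have hnonpos : ∀ i x, ρ i x * F x ≤ 0 := fun i x ↦
    mul_nonpos_of_nonneg_of_nonpos (ρ.nonneg i x) (hdiv x)
  have hzero := (Finset.sum_eq_zero_iff_of_nonpos fun i _ ↦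
    chartIntegral_nonpos b μ (hnonpos i)).mp htotal
  have hx : ∀ i, ρ i x * F x = 0 := fun i ↦
    eq_zero_of_chartIntegral_eq_zero b μ ((hρs i).continuous.mul hF)
      ((tsupport_mul_subset_left (g := F)).trans (hρ i)) (hnonpos i)
      (hzero i (Finset.mem_univ i)) x
  calc F x = ∑ i, ρ i x * F x := by rw [← Finset.sum_mul, hsum, one_mul]
    _ = 0 := Finset.sum_eq_zero fun i _ ↦ hx i

end Global

/-! ### Gluing the local fields and conclusion. -/

section LeeForm

lemma IsKaehlerChart.mono {E : Type*} [NormedAddCommGroup E] [NormedSpace ℝ E] {Ω Ω' : Set E}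
    {g : E → E →L[ℝ] E →L[ℝ] ℝ} {Γ : E → E →L[ℝ] E →L[ℝ] E} {J : E → E →L[ℝ] E}
    (h : IsKaehlerChart Ω g Γ J) (hΩ' : IsOpen Ω') (hsub : Ω' ⊆ Ω) : IsKaehlerChart Ω' g Γ J where
  isOpen := hΩ'
  contDiffOn_metric := h.contDiffOn_metric.mono hsub
  contDiffOn_christoffel := h.contDiffOn_christoffel.mono hsub
  contDiffOn_complex := h.contDiffOn_complex.mono hsub
  metric_symm q hq := h.metric_symm q (hsub hq)
  metric_pos q hq := h.metric_pos q (hsub hq)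
  christoffel_symm q hq := h.christoffel_symm q (hsub hq)
  metric_parallel q hq := h.metric_parallel q (hsub hq)
  complex_parallel q hq := h.complex_parallel q (hsub hq)
  complex_sq q hq := h.complex_sq q (hsub hq)
  complex_orthogonal q hq := h.complex_orthogonal q (hsub hq)

variable {E : Type*} [NormedAddCommGroup E] [NormedSpace ℝ E]
  {M : Type*} [TopologicalSpace M] [ChartedSpace E M]
  [RiemannianBundle (fun x : M ↦ TangentSpace 𝓘(ℝ, E) x)]

/-- The value at `x` of the Bochner difference of a unit vector `e`, where `Z` is the metric dual of
the Lee form. -/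
def bochnerVector (J : Π x : M, TangentSpace 𝓘(ℝ, E) x →L[ℝ] TangentSpace 𝓘(ℝ, E) x)
    {x : M} (Z e : TangentSpace 𝓘(ℝ, E) x) : TangentSpace 𝓘(ℝ, E) x :=
  Z + (((Module.finrank ℝ E : ℝ) - 3) * tangentMetric x Z e) • e -
    tangentMetric x Z (J x e) • J x e

/-- Quadratic dependence on `e`: the two unit vectors of a line give the same value, so no
orientation of the line is needed. -/
lemma bochnerVector_smul (J : Π x : M, TangentSpace 𝓘(ℝ, E) x →L[ℝ] TangentSpace 𝓘(ℝ, E) x)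
    {x : M} (Z e : TangentSpace 𝓘(ℝ, E) x) {r : ℝ} (hr : r * r = 1) :
    bochnerVector J Z (r • e) = bochnerVector J Z e := by
  have h1 : J x (r • e) = r • J x e := (J x).map_smul r e
  rw [bochnerVector, bochnerVector, h1, tangentMetric_smul_right, tangentMetric_smul_right,
    smul_smul, smul_smul]
  congr 3
  · linear_combination ((Module.finrank ℝ E : ℝ) - 3) * tangentMetric x Z e * hr
  · linear_combination tangentMetric x Z (J x e) * hr

variable [FiniteDimensional ℝ E] [IsManifold 𝓘(ℝ, E) ∞ M]
  [IsContMDiffRiemannianBundle 𝓘(ℝ, E) ∞ E (fun x : M ↦ TangentSpace 𝓘(ℝ, E) x)] [T2Space M]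

/-- The local form of the Bochner identity for the Lee form of a conformal product. -/
lemma contMDiffOn_bochnerVector_and_divergence
    {J : Π x : M, TangentSpace 𝓘(ℝ, E) x →L[ℝ] TangentSpace 𝓘(ℝ, E) x} (hJ : IsKaehler J)
    {D nabla : CovariantDerivative 𝓘(ℝ, E) E (TangentSpace 𝓘(ℝ, E) : M → Type _)}
    (hnabla : IsLeviCivita nabla) (hpar : IsParallelEndomorphism nabla J)
    {θ : Π x : M, TangentSpace 𝓘(ℝ, E) x →L[ℝ] ℝ} (hθ : IsLeeForm D θ) (hD : D.torsion = 0)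
    {c : M} {U : Set M} (hU : IsOpen U) (hUc : U ⊆ (extChartAt 𝓘(ℝ, E) c).source)
    {ξ Z V : Π x : M, TangentSpace 𝓘(ℝ, E) x}
    (hξ : ContMDiffOn 𝓘(ℝ, E) 𝓘(ℝ, E).tangent ∞
      (fun x ↦ (⟨x, ξ x⟩ : TangentBundle 𝓘(ℝ, E) M)) U)
    (hunit : ∀ x ∈ U, tangentMetric x (ξ x) (ξ x) = 1)
    (hξpar : ∀ x ∈ U, ∀ v, ∃ r : ℝ, D ξ x v = r • ξ x)
    (hZ : ∀ x ∈ U, ∀ z, tangentMetric x (Z x) z = θ x z)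
    (hV : ∀ x ∈ U, V x = bochnerVector J (Z x) (ξ x)) :
    ContMDiffOn 𝓘(ℝ, E) 𝓘(ℝ, E).tangent ∞
      (fun x ↦ (⟨x, V x⟩ : TangentBundle 𝓘(ℝ, E) M)) U ∧
    ∀ x ∈ U, divergence nabla V x =
      -(((Module.finrank ℝ E : ℝ) - 2) ^ 2 * tangentMetric x (Z x) (ξ x) ^ 2) := by
  set φ := extChartAt 𝓘(ℝ, E) c with hφ
  set Ω := φ.target ∩ φ.symm ⁻¹' U with hΩ
  have hΩo : IsOpen Ω := (continuousOn_extChartAt_symm c).isOpen_inter_preimage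
    (isOpen_extChartAt_target c) hU
  have hK := (hJ.isKaehlerChart hnabla hpar c).mono hΩo Set.inter_subset_left
  let ξ' : E → E := (fun y ↦ coframe c y (ξ y)) ∘ φ.symm
  let Z' : E → E := (fun y ↦ coframe c y (Z y)) ∘ φ.symm
  have hξ' : ContDiffOn ℝ ∞ ξ' Ω :=
    contDiffOn_comp_extChartAt_symm (contMDiffOn_coframe hU hUc hξ)
  have hunit' : ∀ q ∈ Ω, chartMetric c q (ξ' q) (ξ' q) = 1 := fun q hq ↦ by
    rw [chartMetric_apply]
    simp only [ξ', Function.comp_apply]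
    rw [frame_coframe (hUc hq.2)]
    exact hunit _ hq.2
  have hZξ' : ∀ q ∈ Ω, chartMetric c q (Z' q) (ξ' q) =
      tangentMetric (φ.symm q) (Z (φ.symm q)) (ξ (φ.symm q)) := fun q hq ↦ by
    rw [chartMetric_apply]
    simp only [ξ', Z', Function.comp_apply]
    rw [frame_coframe (hUc hq.2), frame_coframe (hUc hq.2)]
  have hcov' : ∀ q ∈ Ω, ∀ v, covDeriv (christoffel nabla c) ξ' q v =
      -(chartMetric c q (Z' q) (ξ' q)) • v + chartMetric c q v (ξ' q) • Z' q := fun q hq v ↦ by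
    have h1 := covDeriv_christoffel nabla hq.1 (mdifferentiableAt_of_contMDiffOn hU hq.2 hξ) v
    refine h1.trans ?_
    rw [hθ.cov_unit hD hnabla hU hξ hunit hξpar hq.2 (hZ _ hq.2), hZξ' q hq, map_add, map_smul,
      map_smul, coframe_frame (hUc hq.2), chartMetric_apply]
    simp only [ξ', Z', Function.comp_apply]
    rw [frame_coframe (hUc hq.2)]
  have hW := hK.contDiffOn_bochnerDifference hξ'
  have hVW : ∀ q ∈ Ω, coframe c (φ.symm q) (V (φ.symm q)) =
      bochnerDifference (christoffel nabla c) (chartEndomorphism J c) ξ' q := fun q hq ↦ by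
    rw [hK.bochnerDifference_eq hξ' hunit' hcov' hq, hV _ hq.2, bochnerVector, map_sub, map_add,
      map_smul, map_smul, hZξ' q hq, chartMetric_apply]
    simp only [ξ', Z', Function.comp_apply, chartEndomorphism, ContinuousLinearMap.comp_apply]
    rw [frame_coframe (hUc hq.2), frame_coframe (hUc hq.2), frame_coframe (hUc hq.2)]
  have hφU : ∀ x ∈ U, φ x ∈ Ω ∧ φ.symm (φ x) = x := fun x hx ↦ by
    have := φ.left_inv (hUc hx)
    exact ⟨⟨φ.map_source (hUc hx), by rwa [Set.mem_preimage, this]⟩, this⟩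
  have hVs : ContMDiffOn 𝓘(ℝ, E) 𝓘(ℝ, E).tangent ∞
      (fun x ↦ (⟨x, V x⟩ : TangentBundle 𝓘(ℝ, E) M)) U := by
    have h1 : ContMDiffOn 𝓘(ℝ, E) 𝓘(ℝ, E) ∞ (fun x ↦
        bochnerDifference (christoffel nabla c) (chartEndomorphism J c) ξ' (φ x)) U :=
      hW.contMDiffOn.comp ((contMDiffOn_extChartAt (x := c)).mono fun x hx ↦ by
        simpa [hφ] using hUc hx) fun x hx ↦ (hφU x hx).1
    refine (contMDiffOn_frame_apply hU hUc h1).congr fun x hx ↦ ?_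
    obtain ⟨hp, hxp⟩ := hφU x hx
    have h2 := hVW _ hp
    rw [hxp] at h2
    rw [← h2, frame_coframe (hUc hx)]
  refine ⟨hVs, fun x hx ↦ ?_⟩
  obtain ⟨hp, hxp⟩ := hφU x hx
  have hdiv := divergence_symm_apply (nabla := nabla) hp.1
    (mdifferentiableAt_of_contMDiffOn hU hp.2 hVs)
  -- Agreement on a neighbourhood, not just at the point, is what lets the divergence of `V` be
  -- computed from the chart field.
  have hev : ((fun y ↦ coframe c y (V y)) ∘ φ.symm) =ᶠ[𝓝 (φ x)]
      bochnerDifference (christoffel nabla c) (chartEndomorphism J c) ξ' := by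
    filter_upwards [hΩo.mem_nhds hp] with q hq using hVW q hq
  rw [covDeriv, hev.fderiv_eq, hev.eq_of_nhds] at hdiv
  have htr := hK.trace_covDeriv_bochnerDifference hξ' hcov' hp
  rw [hZξ' _ hp] at htr
  have h := hdiv.trans htr
  rwa [hxp] at h

variable [CompactSpace M]

/-- The local Bochner fields glue to a global field whose divergence is -(n - 2)² θ(ξ)², and
compactness forces this to vanish. -/
lemma IsKaehler.leeForm_eq_zero
    {J : Π x : M, TangentSpace 𝓘(ℝ, E) x →L[ℝ] TangentSpace 𝓘(ℝ, E) x} (hJ : IsKaehler J)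
    (hdim : Module.finrank ℝ E ≠ 2)
    {D : CovariantDerivative 𝓘(ℝ, E) E (TangentSpace 𝓘(ℝ, E) : M → Type _)}
    (hD : D.torsion = 0) {T : Π x : M, Submodule ℝ (TangentSpace 𝓘(ℝ, E) x)}
    (hT : IsSmoothDistribution T 1) (hTpar : IsParallelDistribution D T)
    {θ : Π x : M, TangentSpace 𝓘(ℝ, E) x →L[ℝ] ℝ} (hθ : IsLeeForm D θ)
    {x : M} {v : TangentSpace 𝓘(ℝ, E) x} (hv : v ∈ T x) : θ x v = 0 := by
  obtain ⟨nabla, hnabla, hpar⟩ := hJ.parallel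
  have hloc : ∀ c : M, ∃ U : Set M, IsOpen U ∧ c ∈ U ∧ U ⊆ (extChartAt 𝓘(ℝ, E) c).source ∧
      ∃ ξ : Π x : M, TangentSpace 𝓘(ℝ, E) x,
        ContMDiffOn 𝓘(ℝ, E) 𝓘(ℝ, E).tangent ∞
          (fun x ↦ (⟨x, ξ x⟩ : TangentBundle 𝓘(ℝ, E) M)) U ∧
        (∀ x ∈ U, tangentMetric x (ξ x) (ξ x) = 1) ∧
        (∀ x ∈ U, ∀ v, v ∈ T x ↔ ∃ r : ℝ, v = r • ξ x) ∧
        ∀ x ∈ U, ∀ v, ∃ r : ℝ, D ξ x v = r • ξ x := fun c ↦ by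
    obtain ⟨U, hU, hc, ξ, hξ, hunit, hspan⟩ := hT.exists_unit c
    refine ⟨U ∩ (extChartAt 𝓘(ℝ, E) c).source, hU.inter (isOpen_extChartAt_source c),
      ⟨hc, mem_extChartAt_source c⟩, Set.inter_subset_right, ξ, hξ.mono Set.inter_subset_left,
      fun x hx ↦ hunit x hx.1, fun x hx ↦ hspan x hx.1, fun x hx v ↦ ?_⟩
    exact (hspan x hx.1 _).mp (hTpar U hU ξ hξ
      (fun y hy ↦ (hspan y hy _).mpr ⟨1, (one_smul ℝ _).symm⟩) x hx.1 v)
  have hex : ∀ x : M, ∃ e Z : TangentSpace 𝓘(ℝ, E) x, tangentMetric x e e = 1 ∧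
      (∀ v, v ∈ T x ↔ ∃ r : ℝ, v = r • e) ∧ ∀ z, tangentMetric x Z z = θ x z := fun x ↦ by
    obtain ⟨U, hU, hx, -, ξ, hξ, hunit, hspan, hξpar⟩ := hloc x
    exact ⟨ξ x, _, hunit x hx, hspan x hx,
      hθ.tangentMetric_dual hD hnabla hU hξ hunit hξpar hx⟩
  -- The unit vectors `e x` are chosen pointwise, with no continuity. Locally `e` is ± a smooth unit
  -- field, so `V` is smooth all the same.
  choose e Z hunit hspan hZ using hex
  let V : Π x : M, TangentSpace 𝓘(ℝ, E) x := fun x ↦ bochnerVector J (Z x) (e x)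
  have key : ∀ c : M, ∃ U : Set M, IsOpen U ∧ c ∈ U ∧
      ContMDiffOn 𝓘(ℝ, E) 𝓘(ℝ, E).tangent ∞
        (fun x ↦ (⟨x, V x⟩ : TangentBundle 𝓘(ℝ, E) M)) U ∧
      ∀ x ∈ U, divergence nabla V x =
        -(((Module.finrank ℝ E : ℝ) - 2) ^ 2 * tangentMetric x (Z x) (e x) ^ 2) := fun c ↦ by
    obtain ⟨U, hU, hc, hUc, ξ, hξ, hξunit, hξspan, hξpar⟩ := hloc c
    have hsign : ∀ x ∈ U, ∃ r : ℝ, r * r = 1 ∧ e x = r • ξ x := fun x hx ↦ by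
      obtain ⟨r, hr⟩ := (hξspan x hx (e x)).mp ((hspan x _).mpr ⟨1, (one_smul ℝ _).symm⟩)
      refine ⟨r, ?_, hr⟩
      have h1 := hunit x
      rwa [hr, tangentMetric_smul_left, tangentMetric_smul_right, hξunit x hx, mul_one] at h1
    obtain ⟨h1, h2⟩ := contMDiffOn_bochnerVector_and_divergence hJ hnabla hpar hθ hD hU hUc hξ
      hξunit hξpar (fun x _ ↦ hZ x) (V := V) fun x hx ↦ by
        obtain ⟨r, hr, hre⟩ := hsign x hx
        simp only [V]
        rw [hre, bochnerVector_smul J _ _ hr]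
    refine ⟨U, hU, hc, h1, fun x hx ↦ ?_⟩
    obtain ⟨r, hr, hre⟩ := hsign x hx
    rw [h2 x hx, hre, tangentMetric_smul_right, mul_pow, pow_two r, hr, one_mul]
  have hVs : ContMDiff 𝓘(ℝ, E) 𝓘(ℝ, E).tangent ∞
      (fun x ↦ (⟨x, V x⟩ : TangentBundle 𝓘(ℝ, E) M)) := fun c ↦ by
    obtain ⟨U, hU, hc, h1, -⟩ := key c
    exact h1.contMDiffAt (hU.mem_nhds hc)
  have hdiv : ∀ x, divergence nabla V x =
      -(((Module.finrank ℝ E : ℝ) - 2) ^ 2 * tangentMetric x (Z x) (e x) ^ 2) := fun c ↦ by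
    obtain ⟨U, -, hc, -, h2⟩ := key c
    exact h2 c hc
  have h0 := divergence_eq_zero_of_nonpos hnabla hVs (fun y ↦ by
    rw [hdiv y]
    exact neg_nonpos.mpr (mul_nonneg (sq_nonneg _) (sq_nonneg _))) x
  have hne : ((Module.finrank ℝ E : ℝ) - 2) ^ 2 ≠ 0 :=
    pow_ne_zero 2 (sub_ne_zero.mpr (by exact_mod_cast hdim))
  rw [hdiv x, neg_eq_zero, hZ] at h0
  have hθe : θ x (e x) = 0 := by
    simpa [hne] using h0
  obtain ⟨r, rfl⟩ := (hspan x v).mp hv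
  rw [(θ x).map_smul, hθe, smul_zero]

end LeeForm

end ConformalProduct

end

theorem theorem4p3 {n : ℕ} (hn : 4 ≤ n)
    {M : Type*} [TopologicalSpace M] [T2Space M] [CompactSpace M]
    [ChartedSpace (EuclideanSpace ℝ (Fin n)) M] [IsManifold (𝓡 n) ∞ M]
    [RiemannianBundle (fun x : M ↦ TangentSpace (𝓡 n) x)]
    [IsContMDiffRiemannianBundle (𝓡 n) ∞ (EuclideanSpace ℝ (Fin n))
      (fun x : M ↦ TangentSpace (𝓡 n) x)]
    (J : Π x : M, TangentSpace (𝓡 n) x →L[ℝ] TangentSpace (𝓡 n) x)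
    (hJ : ConformalProduct.IsKaehler J)
    (D : CovariantDerivative (𝓡 n) (EuclideanSpace ℝ (Fin n))
      (TangentSpace (𝓡 n) : M → Type _))
    (T₁ T₂ : Π x : M, Submodule ℝ (TangentSpace (𝓡 n) x))
    (hD : ConformalProduct.IsConformalProductStructure D T₁ T₂ 1)
    (θ : Π x : M, TangentSpace (𝓡 n) x →L[ℝ] ℝ)
    (hθ : ConformalProduct.IsLeeForm D θ) :
    ∀ x : M, ∀ v ∈ T₂ x, θ x v = 0 := by
  intro x v hv
  -- The dimension enters through n ≠ 2, the nonvanishing of the factor (n - 2)².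
  exact hJ.leeForm_eq_zero (by rw [finrank_euclideanSpace_fin]; omega) hD.weyl.torsion_eq_zero
    hD.distribution₂ hD.parallel₂ hθ hv
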